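/- Let $K$ be a real Hilbert space. Let $\mathcal G(K)$ be the Grassmann manifold of $K$: the set of nonzero proper complemented subspaces of $K$, with the real analytic Banach manifold structure whose charts, one for each pair of complementary $E_0,F_0\in\mathcal G(K)$, send a complement $E=(I+T)(E_0)$ of $F_0$, $T\in\mathcal L(E_0,F_0)$, to $T$. Its tangent space at $E$ is identified, by means of the chart given by $(E,E^\perp)$, with $\mathcal L(E,E^\perp)$, so that the total space $\mathbf T(\mathcal G(K))$ of the tangent bundle, with its usual analytic manifold structure, is the set of pairs $(E,T)$ with $E\in\mathcal G(K)$ and $T\in\mathcal L(E,E^\perp)$. Let $\bar P_E:K\to E$ denote the orthogonal projection and $\mathcal L(K)$ the Banach space of bounded operators on $K$. A tangent vector $T\in\mathcal L(E,E^\perp)$ is also identified with the operator $\tilde T:=T^*\bar P_{E^\perp}\in\mathcal L(K)$, which vanishes on $E$ and has values in $E$; put $\langle S,T\rangle_{\mathcal L(K)}:=\tilde S\,\tilde T^{*}\in\mathcal L(K)$ for $S,T\in\mathcal L(E,E^\perp)$. (a) The assignment $(E,T)\mapsto (E,T\bar P_E)$ is a real analytic immersion (all differentials are injective with complemented range) of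 $\mathbf T(\mathcal G(K))$ into the trivial Banach bundle $\mathcal G(K)\times\mathcal L(K)\to\mathcal G(K)$, it covers the identity of $\mathcal G(K)$ and is linear on each fibre. It is a homeomorphism from $\mathbf T(\mathcal G(K))$ onto $$\{(E,S): E\in\mathcal G(K),\ S\in\mathcal L(K),\ S(E^\perp)=\{0\},\ S(K)\subseteq E^\perp\},$$ which is a real analytic Banach subbundle of the trivial bundle. (b) For every $x\in K$, $\langle S,T\rangle_x:=\langle\langle S,T\rangle_{\mathcal L(K)}\,x,x\rangle$ is a real analytic pseudo-metric on $\mathbf T(\mathcal G(K))$ (a symmetric positive semi-definite bilinear form on each tangent space, depending analytically on the base point). The family $(\langle\cdot,\cdot\rangle_x)_{x\in K}$ is separating: if $\langle S,S\rangle_x=0$ for all $x\in K$, then $S=0$. If $K$ is separable, there is a sequence $(x_n)$ in $K$ such that the countable family $(\langle\cdot,\cdot\rangle_{x_n})_n$ is already separating. (c) The set $\mathcal G(K)_{\mathrm{fin}}$ of finite dimensional members of $\mathcal G(K)$ is open in $\mathcal G(K)$, for $E\in\mathcal G(K)_{\mathrm{fin}}$ and $S,T\in\mathcal L(E,E^\perp)$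 the operator $\langle S,T\rangle_{\mathcal L(K)}$ has finite rank, and $\langle S,T\rangle_{\mathrm{fin}}:=\mathrm{Tr}\,\langle S,T\rangle_{\mathcal L(K)}$ is a real analytic Riemannian metric on $\mathbf T(\mathcal G(K)_{\mathrm{fin}})$: an inner product on each tangent space, inducing its topology and depending analytically on the base point. -/

import Mathlib

open Set Topology

universe u

noncomputable section

/-! ## Real analytic Banach manifolds modelled on varying Banach spaces -/

/-- A real analytic Banach manifold: a topological space with a family of charts onto open
subsets of real Banach spaces (which may vary with the chart), covering the space, with real
analytic transition maps.  As part of the data we pick a preferred chart around every point. -/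
class AnalyticBanachManifold (M : Type u) [TopologicalSpace M] where
  Idx : Type u
  Model : Idx → Type u
  normedAddCommGroup : ∀ i, NormedAddCommGroup (Model i)
  normedSpace : ∀ i, NormedSpace ℝ (Model i)
  completeSpace : ∀ i, CompleteSpace (Model i)
  chart : ∀ i, OpenPartialHomeomorph M (Model i)
  idxAt : M → Idx
  mem_source : ∀ x, x ∈ (chart (idxAt x)).source
  analytic : ∀ i j, AnalyticOnNhd ℝ (fun y => chart j ((chart i).symm y))
    ((chart i).target ∩ (chart i).symm ⁻¹' (chart j).source)

/-- An analytic atlas on a bare set: injective charts onto open subsets of Banach spaces such that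
all overlaps are open and all transition maps are real analytic. -/
structure AnalyticAtlas (M : Type u) where
  Idx : Type u
  Model : Idx → Type u
  normedAddCommGroup : ∀ i, NormedAddCommGroup (Model i)
  normedSpace : ∀ i, NormedSpace ℝ (Model i)
  completeSpace : ∀ i, CompleteSpace (Model i)
  chart : ∀ i, PartialEquiv M (Model i)
  idxAt : M → Idx
  mem_source : ∀ x, x ∈ (chart (idxAt x)).source
  isOpen_target : ∀ i, IsOpen (chart i).target
  isOpen_overlap : ∀ i j, IsOpen ((chart i).target ∩ (chart i).symm ⁻¹' (chart j).source)
  analytic : ∀ i j, AnalyticOnNhd ℝ (fun y => chart j ((chart i).symm y))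
    ((chart i).target ∩ (chart i).symm ⁻¹' (chart j).source)

namespace AnalyticAtlas

attribute [instance] AnalyticAtlas.normedAddCommGroup AnalyticAtlas.normedSpace
  AnalyticAtlas.completeSpace

variable {M : Type u} (A : AnalyticAtlas M)

/-- The topology of an atlas: a set is open iff it is open in every chart. -/
@[reducible] def topology : TopologicalSpace M where
  IsOpen U := ∀ i, IsOpen ((A.chart i).target ∩ (A.chart i).symm ⁻¹' U)
  isOpen_univ i := by simpa using A.isOpen_target i
  isOpen_inter U V hU hV i := by
    have := (hU i).inter (hV i)
    rwa [← inter_inter_distrib_left, ← preimage_inter] at this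
  isOpen_sUnion S hS i := by
    rw [preimage_sUnion, inter_iUnion₂]
    exact isOpen_biUnion fun U hU => hS U hU i

/-- For the topology of an atlas, its charts are homeomorphisms between open sets. -/
def homeoChart (i : A.Idx) : @OpenPartialHomeomorph M (A.Model i) A.topology _ :=
  letI := A.topology
  { toPartialEquiv := A.chart i
    open_source := fun j => A.isOpen_overlap j i
    open_target := A.isOpen_target i
    continuousOn_toFun := by
      have hs : IsOpen (A.chart i).source := fun j => A.isOpen_overlap j i
      refine (continuousOn_open_iff hs).2 fun V hV j => ?_
      have h := (A.analytic j i).continuousOn.isOpen_inter_preimage (A.isOpen_overlap j i) hV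
      convert h using 1
      ext y
      simp only [mem_inter_iff, mem_preimage]
      tauto
    continuousOn_invFun :=
      (continuousOn_open_iff (A.isOpen_target i)).2 fun _ hU => hU i }

/-- The manifold defined by an atlas. -/
@[reducible] def toManifold : @AnalyticBanachManifold M A.topology :=
  letI := A.topology
  { Idx := A.Idx
    Model := A.Model
    normedAddCommGroup := A.normedAddCommGroup
    normedSpace := A.normedSpace
    completeSpace := A.completeSpace
    chart := A.homeoChart
    idxAt := A.idxAt
    mem_source := A.mem_source
    analytic := A.analytic }

end AnalyticAtlas

namespace AnalyticBanachManifold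

attribute [reducible, instance] AnalyticBanachManifold.normedAddCommGroup
  AnalyticBanachManifold.normedSpace
attribute [instance] AnalyticBanachManifold.completeSpace

/-- A Banach space as a manifold with the identity as only chart. -/
instance ofBanach (Y : Type u) [NormedAddCommGroup Y] [NormedSpace ℝ Y] [CompleteSpace Y] :
    AnalyticBanachManifold Y where
  Idx := PUnit
  Model _ := Y
  normedAddCommGroup _ := inferInstance
  normedSpace _ := inferInstance
  completeSpace _ := inferInstance
  chart _ := OpenPartialHomeomorph.refl Y
  idxAt _ := PUnit.unit
  mem_source _ := mem_univ _
  analytic _ _ := fun _ _ => analyticAt_id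

/-- The product of two manifolds, with product charts. -/
instance prod (M N : Type u) [TopologicalSpace M] [AnalyticBanachManifold M]
    [TopologicalSpace N] [AnalyticBanachManifold N] : AnalyticBanachManifold (M × N) where
  Idx := Idx M × Idx N
  Model i := Model i.1 × Model i.2
  normedAddCommGroup _ := inferInstance
  normedSpace _ := inferInstance
  completeSpace _ := inferInstance
  chart i := (chart i.1).prod (chart i.2)
  idxAt x := (idxAt x.1, idxAt x.2)
  mem_source x := ⟨mem_source x.1, mem_source x.2⟩
  analytic i j := by
    rintro ⟨y, z⟩ ⟨⟨hy, hz⟩, hy', hz'⟩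
    exact ((analytic i.1 j.1 y ⟨hy, hy'⟩).comp_of_eq analyticAt_fst rfl).prod
      ((analytic i.2 j.2 z ⟨hz, hz'⟩).comp_of_eq analyticAt_snd rfl)

section Maps

variable {M N : Type u} [TopologicalSpace M] [AnalyticBanachManifold M]
  [TopologicalSpace N] [AnalyticBanachManifold N]

/-- `f` written in the preferred charts at `x` and `f x`. -/
def localRep (f : M → N) (x : M) : Model (idxAt x) → Model (idxAt (f x)) :=
  fun y => chart (idxAt (f x)) (f ((chart (idxAt x)).symm y))

/-- `f` is real analytic at `x`: it is continuous at `x` and analytic there in charts. -/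
def MapAnalyticAt (f : M → N) (x : M) : Prop :=
  ContinuousAt f x ∧ AnalyticAt ℝ (localRep f x) (chart (idxAt x) x)

/-- The tangent space at `x`, represented in the preferred chart at `x`. -/
abbrev TangentSp (x : M) : Type u := Model (idxAt x)

/-- The differential of `f` at `x`. -/
def differential (f : M → N) (x : M) : TangentSp x →L[ℝ] TangentSp (f x) :=
  fderiv ℝ (localRep f x) (chart (idxAt x) x)

/-- `f` is an analytic immersion: it is analytic, and all its differentials are injective with
(closed) complemented range. -/
def IsAnalyticImmersion (f : M → N) : Prop :=
  ∀ x, MapAnalyticAt f x ∧ Function.Injective (differential f x) ∧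
    (differential f x).range.ClosedComplemented

end Maps

section Tangent

variable {M : Type u} [TopologicalSpace M] [AnalyticBanachManifold M]

/-- The derivative at (the point corresponding to) `x` of the transition from chart `i` to
chart `j`; it is the change of coordinates for tangent vectors at `x`. -/
def coordChange (i j : Idx M) (x : M) : Model i →L[ℝ] Model j :=
  fderiv ℝ (fun y => chart j ((chart i).symm y)) (chart i x)

theorem hasFDerivAt_transition {i j : Idx M} {x : M} (hi : x ∈ (chart i).source)
    (hj : x ∈ (chart j).source) :
    HasFDerivAt (fun y => chart j ((chart i).symm y)) (coordChange i j x) (chart i x) :=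
  (analytic i j _ ⟨(chart i).map_source hi,
    by simpa [(chart i).left_inv hi] using hj⟩).differentiableAt.hasFDerivAt

theorem coordChange_self {i : Idx M} {x : M} (hi : x ∈ (chart i).source) (v : Model i) :
    coordChange i i x v = v := by
  have h : HasFDerivAt (fun y => chart i ((chart i).symm y)) (ContinuousLinearMap.id ℝ (Model i))
      (chart i x) := by
    refine (hasFDerivAt_id _).congr_of_eventuallyEq ?_
    filter_upwards [(chart i).open_target.mem_nhds ((chart i).map_source hi)] with y hy
    exact (chart i).right_inv hy
  rw [(hasFDerivAt_transition hi hi).unique h]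
  rfl

theorem coordChange_coordChange {i j k : Idx M} {x : M} (hi : x ∈ (chart i).source)
    (hj : x ∈ (chart j).source) (hk : x ∈ (chart k).source) (v : Model i) :
    coordChange j k x (coordChange i j x v) = coordChange i k x v := by
  have hx : chart j ((chart i).symm (chart i x)) = chart j x := by rw [(chart i).left_inv hi]
  have h1 := hasFDerivAt_transition hi hj
  have h2 := hasFDerivAt_transition hj hk
  rw [← hx] at h2
  have h3 := h2.comp (chart i x) h1
  have hU : (chart i).target ∩ (chart i).symm ⁻¹' (chart j).source ∈ 𝓝 (chart i x) :=
    ((chart i).isOpen_inter_preimage_symm (chart j).open_source).mem_nhds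
      ⟨(chart i).map_source hi, by simpa [(chart i).left_inv hi] using hj⟩
  have h4 : HasFDerivAt (fun y => chart k ((chart i).symm y))
      ((coordChange j k x).comp (coordChange i j x)) (chart i x) := by
    refine h3.congr_of_eventuallyEq ?_
    filter_upwards [hU] with y hy
    simp only [Function.comp_apply]
    rw [(chart j).left_inv hy.2]
  exact (DFunLike.congr_fun ((hasFDerivAt_transition hi hk).unique h4) v).symm

variable (M) in
/-- The total space of the tangent bundle: pairs of a point and a tangent vector there. -/
structure TangentTotal : Type u where
  base : M
  vec : TangentSp base

/-- The chart of the tangent bundle induced by a chart `φ` of the manifold: a tangent vector at `x`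
is sent to `φ x` together with its coordinates in the chart `φ`. -/
def tangentChart (i : Idx M) : PartialEquiv (TangentTotal M) (Model i × Model i) where
  toFun p := (chart i p.base, coordChange (idxAt p.base) i p.base p.vec)
  invFun z := ⟨(chart i).symm z.1, coordChange i _ ((chart i).symm z.1) z.2⟩
  source := {p | p.base ∈ (chart i).source}
  target := (chart i).target ×ˢ univ
  map_source' p hp := ⟨(chart i).map_source hp, mem_univ _⟩
  map_target' z hz := (chart i).map_target hz.1
  left_inv' := by
    rintro ⟨x, v⟩ hx
    have key : ∀ y : M, y = x → ∀ w, (⟨y, coordChange i (idxAt y) y w⟩ : TangentTotal M) =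
        ⟨x, coordChange i (idxAt x) x w⟩ := by rintro y rfl w; rfl
    refine (key _ ((chart i).left_inv hx) _).trans ?_
    rw [coordChange_coordChange (mem_source x) hx (mem_source x),
      coordChange_self (mem_source x)]
  right_inv' := by
    rintro ⟨y, w⟩ ⟨hy, -⟩
    have hy' := (chart i).map_target hy
    refine Prod.ext ((chart i).right_inv hy) ?_
    change coordChange _ i ((chart i).symm y) (coordChange i _ ((chart i).symm y) w) = w
    rw [coordChange_coordChange hy' (mem_source _) hy', coordChange_self hy']

theorem tangentChart_overlap (i j : Idx M) :
    (tangentChart i).target ∩ (tangentChart i).symm ⁻¹' (tangentChart j).source =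
      ((chart i).target ∩ (chart i).symm ⁻¹' (chart j).source) ×ˢ univ := by
  ext ⟨y, w⟩
  constructor
  · rintro ⟨⟨h1, -⟩, h2⟩
    exact ⟨⟨h1, h2⟩, mem_univ _⟩
  · rintro ⟨⟨h1, h2⟩, -⟩
    exact ⟨⟨h1, mem_univ _⟩, h2⟩

theorem tangentChart_transition (i j : Idx M) {z : Model i × Model i}
    (hz : z ∈ ((chart i).target ∩ (chart i).symm ⁻¹' (chart j).source) ×ˢ (univ : Set (Model i))) :
    tangentChart j ((tangentChart i).symm z) = (chart j ((chart i).symm z.1),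
      fderiv ℝ (fun y => chart j ((chart i).symm y)) z.1 z.2) := by
  obtain ⟨y, w⟩ := z
  obtain ⟨⟨hy, hyj⟩, -⟩ := hz
  have hy' := (chart i).map_target hy
  refine Prod.ext rfl ?_
  change coordChange (idxAt ((chart i).symm y)) j ((chart i).symm y)
    (coordChange i (idxAt ((chart i).symm y)) ((chart i).symm y) w) = _
  refine (coordChange_coordChange hy' (mem_source _) hyj _).trans ?_
  rw [coordChange, (chart i).right_inv hy]

variable (M) in
/-- The analytic atlas of the tangent bundle. -/
@[reducible] def tangentAtlas : AnalyticAtlas (TangentTotal M) where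
  Idx := Idx M
  Model i := Model i × Model i
  normedAddCommGroup _ := inferInstance
  normedSpace _ := inferInstance
  completeSpace _ := inferInstance
  chart := tangentChart
  idxAt p := idxAt p.base
  mem_source p := mem_source p.base
  isOpen_target i := (chart i).open_target.prod isOpen_univ
  isOpen_overlap i j := by
    rw [tangentChart_overlap]
    exact ((chart i).isOpen_inter_preimage_symm (chart j).open_source).prod isOpen_univ
  analytic i j := by
    rw [tangentChart_overlap]
    have hopen := ((chart i).isOpen_inter_preimage_symm (chart j).open_source).prod
      (isOpen_univ (X := Model i))
    intro z hz
    have h1 : AnalyticAt ℝ (fun z : Model i × Model i => chart j ((chart i).symm z.1)) z :=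
      (analytic i j z.1 hz.1).comp_of_eq analyticAt_fst rfl
    have h2 : AnalyticAt ℝ (fun z : Model i × Model i =>
        fderiv ℝ (fun y => chart j ((chart i).symm y)) z.1 z.2) z := by
      have h3 := ((analytic i j z.1 hz.1).fderiv).comp_of_eq (g := fderiv ℝ _)
        (f := fun z : Model i × Model i => z.1) (x := z) analyticAt_fst rfl
      exact ((ContinuousLinearMap.id ℝ (Model i →L[ℝ] Model j)).analyticAt_bilinear
        (_, _)).comp_of_eq (h3.prod analyticAt_snd) rfl
    refine (h1.prod h2).congr ?_
    filter_upwards [hopen.mem_nhds hz] with z' hz'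
    exact (tangentChart_transition i j hz').symm

instance : TopologicalSpace (TangentTotal M) := (tangentAtlas M).topology

instance : AnalyticBanachManifold (TangentTotal M) := (tangentAtlas M).toManifold

/-- A family of bilinear forms `g` on the tangent spaces is a real analytic pseudo-metric on
the tangent bundle of the open submanifold `U`: each `g x` is bilinear, symmetric and positive
semi-definite, and in every chart `(x, v, w) ↦ g x v w` is real analytic. -/
structure IsAnalyticPseudoMetricOn (U : Set M) (g : ∀ x : M, TangentSp x → TangentSp x → ℝ) :
    Prop where
  linear_left : ∀ x ∈ U, ∀ w, IsLinearMap ℝ (fun v => g x v w)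
  symm : ∀ x ∈ U, ∀ v w, g x v w = g x w v
  nonneg : ∀ x ∈ U, ∀ v, 0 ≤ g x v v
  analytic : ∀ i : Idx M, AnalyticOnNhd ℝ
    (fun z : Model i × Model i × Model i =>
      g ((chart i).symm z.1) (coordChange i _ ((chart i).symm z.1) z.2.1)
        (coordChange i _ ((chart i).symm z.1) z.2.2))
    (((chart i).target ∩ (chart i).symm ⁻¹' U) ×ˢ univ)

/-- A real analytic (Riemannian) metric on the tangent bundle of the open submanifold `U`:
a real analytic pseudo-metric whose values are inner products inducing the topology
of the tangent spaces. -/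
structure IsAnalyticMetricOn (U : Set M) (g : ∀ x : M, TangentSp x → TangentSp x → ℝ) : Prop
    extends IsAnalyticPseudoMetricOn U g where
  definite : ∀ x ∈ U, ∀ v, g x v v = 0 → v = 0
  bounded_below : ∀ x ∈ U, ∃ c : ℝ, 0 < c ∧ ∀ v, c * ‖v‖ ^ 2 ≤ g x v v

/-- A family of pseudo-metrics is separating: a tangent vector on which all of them vanish
is zero. -/
def IsSeparating {ι : Type*} (g : ι → ∀ x : M, TangentSp x → TangentSp x → ℝ) : Prop :=
  ∀ (x : M) (v : TangentSp x), (∀ a, g a x v v = 0) → v = 0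

/-- The family `W` of subspaces of `Y` is an analytic Banach subbundle of the trivial bundle
`M × Y`: the fibres are complemented, and near each point there is an analytic trivialization
`(x, y) ↦ (x, Θ x y)` of the trivial bundle carrying `U × W x₀` onto `{(x, y) | y ∈ W x}`. -/
def IsAnalyticSubbundle {Y : Type u} [NormedAddCommGroup Y] [NormedSpace ℝ Y] [CompleteSpace Y]
    (W : M → Submodule ℝ Y) : Prop :=
  ∀ x₀ : M, (W x₀).ClosedComplemented ∧ ∃ U : Set M, IsOpen U ∧ x₀ ∈ U ∧
    ∃ Θ : M → (Y ≃L[ℝ] Y), (∀ x ∈ U, MapAnalyticAt (fun x => (Θ x : Y →L[ℝ] Y)) x) ∧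
      ∀ x ∈ U, ∀ y : Y, Θ x y ∈ W x ↔ y ∈ W x₀

end Tangent

end AnalyticBanachManifold

/-! ## The Grassmann manifold of a real Hilbert space -/

/-- The Grassmannian: the nonzero proper complemented subspaces of `X`. -/
@[ext] structure Grassmannian (X : Type u) [NormedAddCommGroup X] [NormedSpace ℝ X] : Type u where
  space : Submodule ℝ X
  ne_bot : space ≠ ⊥
  ne_top : space ≠ ⊤
  complemented : space.ClosedComplemented

namespace Grassmannian

open Submodule

section Banach

variable {X : Type u} [NormedAddCommGroup X] [NormedSpace ℝ X]

instance [CompleteSpace X] (E : Grassmannian X) : CompleteSpace E.space :=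
  E.complemented.isClosed.completeSpace_coe

theorem isTopCompl_range {V : Type*} [NormedAddCommGroup V] [NormedSpace ℝ V]
    {E F : Submodule ℝ X} (h : IsTopCompl E F) (w : V →L[ℝ] X) (e : V ≃L[ℝ] E)
    (he : (e : V →L[ℝ] E) = E.projectionOntoL F h ∘L w) : IsTopCompl w.range F := by
  have he' : ∀ v, E.projectionOntoL F h (w v) = e v := fun v => by
    rw [← ContinuousLinearEquiv.coe_coe, he]; rfl
  set P : X →L[ℝ] X := w ∘L (e.symm : E →L[ℝ] V) ∘L E.projectionOntoL F h with hP
  have hPx : ∀ x, P x = w (e.symm (E.projectionOntoL F h x)) := fun x => rfl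
  have hPw : ∀ v, P (w v) = w v := fun v => by
    rw [hPx, he', e.symm_apply_apply]
  have hid : IsIdempotentElem P := by
    ext x
    exact hPw _
  have hr : P.range = w.range := by
    ext x
    constructor
    · rintro ⟨y, rfl⟩
      exact ⟨_, rfl⟩
    · rintro ⟨v, rfl⟩
      exact ⟨w v, hPw v⟩
  have hk : P.ker = F := by
    ext x
    rw [← projectionOntoL_apply_eq_zero_iff h]
    constructor
    · intro hx
      have h0 : w (e.symm (E.projectionOntoL F h x)) = 0 := hx
      have h1 := he' (e.symm (E.projectionOntoL F h x))
      rw [h0, map_zero, e.apply_symm_apply] at h1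
      exact h1.symm
    · intro hx
      change w (e.symm (E.projectionOntoL F h x)) = 0
      rw [hx, map_zero, map_zero]
  have := ContinuousLinearMap.IsIdempotentElem.isTopCompl hid
  rwa [hr, hk] at this

theorem exists_equiv {V : Type*} [NormedAddCommGroup V] [NormedSpace ℝ V]
    {E F : Submodule ℝ X} (h : IsTopCompl E F) (w : V →L[ℝ] X) (s : X →L[ℝ] V)
    (hs : ∀ v, s (w v) = v) (hw : IsTopCompl w.range F) :
    ∃ e : V ≃L[ℝ] E, (e : V →L[ℝ] E) = E.projectionOntoL F h ∘L w := by
  have hF : ∀ x, x ∈ F → E.projectionOntoL F h x = 0 := fun x =>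
    (projectionOntoL_apply_eq_zero_iff h).2
  have hF' : ∀ x, x ∈ F → w.range.projectionL F hw x = 0 := fun x =>
    (projectionL_apply_eq_zero_iff hw).2
  refine ⟨ContinuousLinearEquiv.equivOfInverse (E.projectionOntoL F h ∘L w)
    (s ∘L w.range.projectionL F hw ∘L E.subtypeL) ?_ ?_, rfl⟩
  · intro v
    change s (w.range.projectionL F hw (E.projectionL F h (w v))) = v
    have h1 : w.range.projectionL F hw (w v - E.projectionL F h (w v)) = 0 := by
      apply hF'
      rw [← projectionL_eq_self_sub_projectionL h]
      exact projectionL_apply_mem _ _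
    have h2 : w.range.projectionL F hw (w v) = w v :=
      (projectionL_eq_self_iff hw _).2 ⟨v, rfl⟩
    rw [map_sub, sub_eq_zero, h2] at h1
    rw [← h1, hs]
  · intro x
    change E.projectionOntoL F h (w (s (w.range.projectionL F hw x))) = x
    obtain ⟨v, hv⟩ : w.range.projectionL F hw x ∈ w.range := projectionL_apply_mem _ _
    have hv' : w v = w.range.projectionL F hw x := hv
    have h1 : E.projectionOntoL F h (x - w.range.projectionL F hw x) = 0 := by
      apply hF
      rw [← projectionL_eq_self_sub_projectionL hw]
      exact projectionL_apply_mem _ _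
    rw [map_sub, sub_eq_zero, projectionOntoL_apply_left] at h1
    rw [← hv', hs, hv', ← h1]

/-- For `T : E → F`, the map `I + T : E → X`. -/
def graphMap (E F : Submodule ℝ X) (T : E →L[ℝ] F) : E →L[ℝ] X :=
  E.subtypeL + F.subtypeL ∘L T

theorem proj_graphMap {E F : Submodule ℝ X} (h : IsTopCompl E F) (T : E →L[ℝ] F) (x : E) :
    E.projectionOntoL F h (graphMap E F T x) = x := by
  simp only [graphMap, _root_.add_apply, map_add]
  change E.projectionOntoL F h (x : X) + E.projectionOntoL F h (T x : X) = x
  rw [projectionOntoL_apply_left, projectionOntoL_apply_right, add_zero]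

theorem proj_graphMap' {E F : Submodule ℝ X} (h : IsTopCompl E F) (T : E →L[ℝ] F) (x : E) :
    F.projectionOntoL E h.symm (graphMap E F T x) = T x := by
  simp only [graphMap, _root_.add_apply, map_add]
  change F.projectionOntoL E h.symm (x : X) + F.projectionOntoL E h.symm (T x : X) = T x
  rw [projectionOntoL_apply_left, projectionOntoL_apply_right, zero_add]

theorem isTopCompl_graph {E F : Submodule ℝ X} (h : IsTopCompl E F) (T : E →L[ℝ] F) :
    IsTopCompl (graphMap E F T).range F :=
  isTopCompl_range h _ (ContinuousLinearEquiv.refl ℝ E) <| by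
    ext x : 1
    exact (proj_graphMap h T x).symm

/-- The subspace `(I + T)(E)` for `T : E → F`, as a point of the Grassmannian. -/
def graph (E F : Grassmannian X) (h : IsTopCompl E.space F.space) (T : E.space →L[ℝ] F.space) :
    Grassmannian X where
  space := (graphMap E.space F.space T).range
  ne_bot h0 := F.ne_top <| by
    simpa [h0] using (isTopCompl_graph h T).isCompl.sup_eq_top
  ne_top h1 := F.ne_bot <| by
    simpa [h1] using (isTopCompl_graph h T).isCompl.inf_eq_bot
  complemented := (isTopCompl_graph h T).closedComplemented

open Classical in
/-- The inverse of `graph`: for a complement `E₁` of `F`, the operator `T : E → F` with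
`E₁ = (I + T)(E)` is minus the projection onto `F` along `E₁`, restricted to `E`. -/
def coord (E F E₁ : Submodule ℝ X) : E →L[ℝ] F :=
  if h : IsTopCompl E₁ F then -(F.projectionOntoL E₁ h.symm ∘L E.subtypeL) else 0

theorem coord_range {V : Type*} [NormedAddCommGroup V] [NormedSpace ℝ V]
    {E F : Submodule ℝ X} (h : IsTopCompl E F) (w : V →L[ℝ] X) (e : V ≃L[ℝ] E)
    (he : (e : V →L[ℝ] E) = E.projectionOntoL F h ∘L w) :
    coord E F w.range = (F.projectionOntoL E h.symm ∘L w) ∘L (e.symm : E →L[ℝ] V) := by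
  have h1 := isTopCompl_range h w e he
  have he' : ∀ v, E.projectionOntoL F h (w v) = e v := fun v => by
    rw [← ContinuousLinearEquiv.coe_coe, he]; rfl
  rw [coord, dif_pos h1]
  ext x : 1
  obtain ⟨v, rfl⟩ := e.surjective x
  change -(F.projectionOntoL _ h1.symm (e v : X)) =
    F.projectionOntoL E h.symm (w (e.symm (e v)))
  rw [e.symm_apply_apply, neg_eq_iff_eq_neg, ← map_neg]
  have h2 : (e v : X) = w v + ((- F.projectionOntoL E h.symm (w v) : F) : X) := by
    have := projectionL_add_projectionL_eq_self h (w v)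
    rw [projectionL_apply, projectionL_apply, he'] at this
    rw [← eq_sub_iff_add_eq] at this
    rw [this, Submodule.coe_neg, sub_eq_add_neg]
  have h3 : F.projectionOntoL _ h1.symm (w v) = 0 :=
    (projectionOntoL_apply_eq_zero_iff h1.symm).2 ⟨v, rfl⟩
  rw [h2, map_add, projectionOntoL_apply_left, h3, zero_add, map_neg]

variable (X) in
/-- Pairs `(E, F)` of complementary points of the Grassmannian. -/
def ComplPair : Type u :=
  {p : Grassmannian X × Grassmannian X // IsTopCompl p.1.space p.2.space}

/-- The chart of the Grassmannian given by a complementary pair `(E, F)`: its domain consists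
of the complements of `F`, and it sends `(I + T)(E)` to `T : E → F`. -/
def grChart (i : ComplPair X) :
    PartialEquiv (Grassmannian X) (i.1.1.space →L[ℝ] i.1.2.space) where
  toFun E₁ := coord i.1.1.space i.1.2.space E₁.space
  invFun T := graph i.1.1 i.1.2 i.2 T
  source := {E₁ | IsTopCompl E₁.space i.1.2.space}
  target := univ
  map_source' _ _ := mem_univ _
  map_target' T _ := isTopCompl_graph i.2 T
  left_inv' := by
    intro E₁ (h1 : IsTopCompl E₁.space i.1.2.space)
    have hr : E₁.space.subtypeL.range = E₁.space := by
      ext x; simp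
    obtain ⟨e, he⟩ := exists_equiv i.2 E₁.space.subtypeL (E₁.space.projectionOntoL _ h1)
      (fun v => projectionOntoL_apply_left h1 v) (by rwa [hr])
    have hc := coord_range i.2 E₁.space.subtypeL e he
    rw [hr] at hc
    have he' : ∀ v : E₁.space, i.1.1.space.projectionOntoL _ i.2 (v : X) = e v := fun v => by
      rw [← ContinuousLinearEquiv.coe_coe, he]; rfl
    have key : ∀ v : E₁.space,
        graphMap i.1.1.space i.1.2.space (coord _ _ E₁.space) (e v) = v := fun v => by
      rw [hc]
      change (e v : X) + ((i.1.2.space.projectionOntoL i.1.1.space i.2.symm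
        ((e.symm (e v) : E₁.space) : X) : i.1.2.space) : X) = v
      rw [e.symm_apply_apply, ← he']
      exact projectionL_add_projectionL_eq_self i.2 (v : X)
    ext x
    constructor
    · rintro ⟨y, rfl⟩
      obtain ⟨v, rfl⟩ := e.surjective y
      have := key v
      change graphMap i.1.1.space i.1.2.space (coord _ _ E₁.space) (e v) ∈ E₁.space
      rw [this]
      exact v.2
    · intro hx
      exact ⟨e ⟨x, hx⟩, key ⟨x, hx⟩⟩
  right_inv' := by
    intro T _
    have hc := coord_range i.2 (graphMap i.1.1.space i.1.2.space T)
      (ContinuousLinearEquiv.refl ℝ _) (by ext x : 1; exact (proj_graphMap i.2 T x).symm)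
    refine hc.trans ?_
    ext x : 1
    exact proj_graphMap' i.2 T x

theorem graph_isTopCompl_iff (i j : ComplPair X) (T : i.1.1.space →L[ℝ] i.1.2.space) :
    IsTopCompl (graph i.1.1 i.1.2 i.2 T).space j.1.2.space ↔
      j.1.1.space.projectionOntoL j.1.2.space j.2 ∘L graphMap i.1.1.space i.1.2.space T ∈
        range ((↑) : (i.1.1.space ≃L[ℝ] j.1.1.space) → (i.1.1.space →L[ℝ] j.1.1.space)) :=
  ⟨fun h => exists_equiv j.2 _ _ (proj_graphMap i.2 T) h,
    fun ⟨e, he⟩ => isTopCompl_range j.2 _ e he⟩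

theorem analyticAt_graphMap (E F : Submodule ℝ X) {Z : Type*} [NormedAddCommGroup Z]
    [NormedSpace ℝ Z] (L : X →L[ℝ] Z) (T : E →L[ℝ] F) :
    AnalyticAt ℝ (fun T : E →L[ℝ] F => L ∘L graphMap E F T) T := by
  have : (fun T : E →L[ℝ] F => L ∘L graphMap E F T) = fun T =>
      L ∘L E.subtypeL + ContinuousLinearMap.compL ℝ E F Z (L ∘L F.subtypeL) T := by
    funext T
    ext x
    simp [graphMap]
  rw [this]
  exact analyticAt_const.add (ContinuousLinearMap.analyticAt _ T)

theorem isOpen_overlap [CompleteSpace X] (i j : ComplPair X) :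
    IsOpen ((grChart i).target ∩ (grChart i).symm ⁻¹' (grChart j).source) := by
  have h : (grChart i).target ∩ (grChart i).symm ⁻¹' (grChart j).source =
      (fun T => j.1.1.space.projectionOntoL j.1.2.space j.2 ∘L
        graphMap i.1.1.space i.1.2.space T) ⁻¹' range ((↑) :
        (i.1.1.space ≃L[ℝ] j.1.1.space) → (i.1.1.space →L[ℝ] j.1.1.space)) := by
    ext T
    exact (and_iff_right (mem_univ _)).trans (graph_isTopCompl_iff i j T)
  rw [h]
  exact ContinuousLinearEquiv.isOpen.preimage
    (continuous_iff_continuousAt.2 fun T => (analyticAt_graphMap _ _ _ T).continuousAt)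

theorem analytic_transition [CompleteSpace X] (i j : ComplPair X) :
    AnalyticOnNhd ℝ (fun T => grChart j ((grChart i).symm T))
      ((grChart i).target ∩ (grChart i).symm ⁻¹' (grChart j).source) := by
  intro T hT
  obtain ⟨e, he⟩ := (graph_isTopCompl_iff i j T).1 hT.2
  have h1 : AnalyticAt ℝ (fun T => ContinuousLinearMap.inverse
      (j.1.1.space.projectionOntoL j.1.2.space j.2 ∘L graphMap i.1.1.space i.1.2.space T)) T := by
    refine AnalyticAt.comp_of_eq (contDiffAt_map_inverse (n := ⊤) e).analyticAt
      (analyticAt_graphMap _ _ _ T) he.symm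
  have h2 := analyticAt_graphMap i.1.1.space i.1.2.space
    (j.1.2.space.projectionOntoL j.1.1.space j.2.symm) T
  have h3 := ((ContinuousLinearMap.compL ℝ j.1.1.space i.1.1.space
    j.1.2.space).analyticAt_bilinear (_, _)).comp_of_eq (h2.prod h1) rfl
  refine h3.congr ?_
  filter_upwards [(isOpen_overlap i j).mem_nhds hT] with S hS
  obtain ⟨e', he'⟩ := (graph_isTopCompl_iff i j S).1 hS.2
  refine Eq.trans ?_ (coord_range j.2 _ e' he').symm
  simp only [Function.comp_apply, ContinuousLinearMap.compL_apply]
  rw [← he', ContinuousLinearMap.inverse_equiv]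

end Banach

section Hilbert

variable {K : Type u} [NormedAddCommGroup K] [InnerProductSpace ℝ K] [CompleteSpace K]

/-- The orthogonal complement, as a point of the Grassmannian. -/
def perp (E : Grassmannian K) : Grassmannian K where
  space := E.spaceᗮ
  ne_bot h := E.ne_top (orthogonal_eq_bot_iff.1 h)
  ne_top h := E.ne_bot ((orthogonal_eq_top_iff _).1 h)
  complemented := (isTopCompl_orthogonal E.space).symm.closedComplemented

variable (K) in
/-- The analytic atlas of the Grassmannian, indexed by all complementary pairs; the preferred
chart at `E` is the one given by `E` and its orthogonal complement. -/
@[reducible] def atlas : AnalyticAtlas (Grassmannian K) where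
  Idx := ComplPair K
  Model i := i.1.1.space →L[ℝ] i.1.2.space
  normedAddCommGroup _ := inferInstance
  normedSpace _ := inferInstance
  completeSpace _ := inferInstance
  chart := grChart
  idxAt E := ⟨(E, E.perp), isTopCompl_orthogonal E.space⟩
  mem_source E := isTopCompl_orthogonal E.space
  isOpen_target _ := isOpen_univ
  isOpen_overlap := isOpen_overlap
  analytic := analytic_transition

instance : TopologicalSpace (Grassmannian K) := (atlas K).topology

instance : AnalyticBanachManifold (Grassmannian K) := (atlas K).toManifold

/-- The tangent space at `E` is the space of bounded operators `E → Eᗮ`. -/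
theorem tangentSp_eq (E : Grassmannian K) :
    AnalyticBanachManifold.TangentSp E = (E.space →L[ℝ] E.spaceᗮ) := rfl

/-! ### The embedding of the tangent bundle into the trivial bundle -/

/-- For a tangent vector `T : E → Eᗮ`, the operator `T ∘ P_E` on `K`, where `P_E : K → E` is
the orthogonal projection. -/
def extend (E : Grassmannian K) (T : E.space →L[ℝ] E.spaceᗮ) : K →L[ℝ] K :=
  E.spaceᗮ.subtypeL ∘L T ∘L E.space.orthogonalProjectionOnto

variable (K) in
/-- The map `(E, T) ↦ (E, T ∘ P_E)` from the total space of the tangent bundle. -/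
def tangentEmbedding (p : AnalyticBanachManifold.TangentTotal (Grassmannian K)) :
    Grassmannian K × (K →L[ℝ] K) :=
  (p.base, extend p.base p.vec)

/-- The operators on `K` vanishing on `Eᗮ` with values in `Eᗮ`. -/
def fibre (E : Grassmannian K) : Submodule ℝ (K →L[ℝ] K) where
  carrier := {S | (∀ x ∈ E.spaceᗮ, S x = 0) ∧ ∀ x, S x ∈ E.spaceᗮ}
  add_mem' {S T} hS hT := ⟨fun x hx => by simp [hS.1 x hx, hT.1 x hx],
    fun x => add_mem (hS.2 x) (hT.2 x)⟩
  zero_mem' := ⟨fun _ _ => rfl, fun _ => zero_mem _⟩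
  smul_mem' c S hS := ⟨fun x hx => by simp [hS.1 x hx], fun x => smul_mem _ c (hS.2 x)⟩

/-! ### The operator valued metric and the trace metric -/

/-- The identification of a tangent vector `T : E → Eᗮ` with an operator on `K` that vanishes on
`E` and takes values in `E`, namely the adjoint `T* : Eᗮ → E` extended by `0` on `E`. -/
def adjointExtend (E : Grassmannian K) (T : E.space →L[ℝ] E.spaceᗮ) : K →L[ℝ] K :=
  E.space.subtypeL ∘L ContinuousLinearMap.adjoint T ∘L E.spaceᗮ.orthogonalProjectionOnto

/-- The operator valued metric `⟨A, B⟩ = A B*`, on tangent vectors of the Grassmannian. -/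
def opMetric (E : Grassmannian K) (S T : E.space →L[ℝ] E.spaceᗮ) : K →L[ℝ] K :=
  adjointExtend E S ∘L ContinuousLinearMap.adjoint (adjointExtend E T)

/-- The form `⟨S, T⟩_x = ⟨⟨S, T⟩ x, x⟩` on the tangent spaces of the Grassmannian. -/
def vecMetric (x : K) (E : Grassmannian K) (S T : AnalyticBanachManifold.TangentSp E) : ℝ :=
  inner ℝ (opMetric E S T x) x

/-- The trace of a finite rank operator: the trace of its restriction to its range. -/
def finRankTrace (A : K →L[ℝ] K) : ℝ :=
  LinearMap.trace ℝ A.range (A.rangeRestrict.toLinearMap ∘ₗ A.range.subtype)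

/-- The form `⟨S, T⟩_fin = Tr ⟨S, T⟩` on the tangent spaces of the Grassmannian. -/
def traceMetric (E : Grassmannian K) (S T : AnalyticBanachManifold.TangentSp E) : ℝ :=
  finRankTrace (opMetric E S T)

variable (K) in
/-- The finite dimensional subspaces in the Grassmannian. -/
def finPart : Set (Grassmannian K) := {E | FiniteDimensional ℝ E.space}

end Hilbert

end Grassmannian

end

/-!
A bounded idempotent `Q` with range `E` determines the orthogonal projection onto `E` by the
Kerzman–Stein formula `P_E = Q (1 + Q - Q*)⁻¹`. In the chart of a complementary pair `(E₀, F₀)` the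
projection `Q_T` onto `(I + T)(E₀)` along `F₀` is affine in `T`, so `E ↦ P_E` is analytic.
Differentiating `P_E (I + T) = I + T` gives `T P_E = dP_E(T) P_E`; hence `(E, T) ↦ T P_E` is
analytic, and the coordinates of `T` in the chart are recovered by projecting `T P_E` onto `F₀`
along `E`. This analytic local left inverse makes the map both an immersion and an embedding. Its
image is the family of Peirce corners `(1 - P_E) L(K) P_E`, trivialised by Kato's intertwiners.

Since `⟨S, T⟩ = (S P_E)* (T P_E)`, the form `⟨·, ·⟩_x` is the pull-back of the inner product of `K`
under `(E, T) ↦ T P_E x`. When `E = (I + T₀)(E₀)` has finite dimension, the trace of an operator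
with values in `E` is that of the operator it induces on the fixed space `E₀` through `I + T₀`, and
therefore depends analytically on the base point.
-/

section Analytic

variable {𝕜 V E F G : Type*} [NontriviallyNormedField 𝕜] [NormedAddCommGroup V] [NormedSpace 𝕜 V]
  [NormedAddCommGroup E] [NormedSpace 𝕜 E] [NormedAddCommGroup F] [NormedSpace 𝕜 F]
  [NormedAddCommGroup G] [NormedSpace 𝕜 G] {z : V}

theorem analyticAt_clm_comp {g : V → F →L[𝕜] G} {f : V → E →L[𝕜] F} (hg : AnalyticAt 𝕜 g z)
    (hf : AnalyticAt 𝕜 f z) : AnalyticAt 𝕜 (fun z => g z ∘L f z) z :=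
  ((ContinuousLinearMap.compL 𝕜 E F G).analyticAt_bilinear (_, _)).comp_of_eq (hg.prod hf) rfl

theorem analyticAt_clm_apply {g : V → E →L[𝕜] F} {f : V → E} (hg : AnalyticAt 𝕜 g z)
    (hf : AnalyticAt 𝕜 f z) : AnalyticAt 𝕜 (fun z => g z (f z)) z :=
  ((ContinuousLinearMap.id 𝕜 (E →L[𝕜] F)).analyticAt_bilinear (_, _)).comp_of_eq (hg.prod hf) rfl

end Analytic

theorem analyticAt_inner {V H : Type*} [NormedAddCommGroup V] [NormedSpace ℝ V]
    [NormedAddCommGroup H] [InnerProductSpace ℝ H] {f g : V → H} {z : V}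
    (hf : AnalyticAt ℝ f z) (hg : AnalyticAt ℝ g z) :
    AnalyticAt ℝ (fun z => inner ℝ (f z) (g z)) z :=
  ((innerSL ℝ).analyticAt_bilinear (_, _)).comp_of_eq (hf.prod hg) rfl

namespace AnalyticBanachManifold

section Charts

variable {M : Type u} [TopologicalSpace M] [AnalyticBanachManifold M]

theorem analyticAt_comp_chart_symm {Y : Type*} [NormedAddCommGroup Y] [NormedSpace ℝ Y]
    {f : M → Y} {x : M} {i j : Idx M} (hi : x ∈ (chart i).source) (hj : x ∈ (chart j).source)
    (hf : AnalyticAt ℝ (fun y => f ((chart i).symm y)) (chart i x)) :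
    AnalyticAt ℝ (fun y => f ((chart j).symm y)) (chart j x) := by
  have hxj : (chart j).symm (chart j x) = x := (chart j).left_inv hj
  have hoverlap : chart j x ∈ (chart j).target ∩ (chart j).symm ⁻¹' (chart i).source :=
    ⟨(chart j).map_source hj, by rwa [mem_preimage, hxj]⟩
  refine (hf.comp_of_eq (analytic j i _ hoverlap) (by rw [hxj])).congr ?_
  filter_upwards [((chart j).isOpen_inter_preimage_symm (chart i).open_source).mem_nhds hoverlap]
    with y hy
  simp only [Function.comp_apply, (chart i).left_inv hy.2]

variable {Y : Type u} [NormedAddCommGroup Y] [NormedSpace ℝ Y] [CompleteSpace Y] {f : M → Y}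

theorem mapAnalyticAt_iff {x : M} {i : Idx M} (hi : x ∈ (chart i).source) :
    MapAnalyticAt f x ↔ AnalyticAt ℝ (fun y => f ((chart i).symm y)) (chart i x) := by
  refine ⟨fun h => analyticAt_comp_chart_symm (mem_source x) hi h.2, fun h =>
    ⟨?_, analyticAt_comp_chart_symm hi (mem_source x) h⟩⟩
  rw [(chart i).symm.continuousAt_iff_continuousAt_comp_right hi]
  exact h.continuousAt

theorem MapAnalyticAt.congr_of_eventuallyEq {g : M → Y} {x : M} (hf : MapAnalyticAt f x)
    (hg : g =ᶠ[𝓝 x] f) : MapAnalyticAt g x := by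
  rw [mapAnalyticAt_iff (mem_source x)] at hf ⊢
  refine hf.congr ?_
  filter_upwards [((chart (idxAt x)).tendsto_symm (mem_source x)).eventually hg] with y hy
  exact hy.symm

theorem MapAnalyticAt.prodMk {N P : Type u} [TopologicalSpace N] [AnalyticBanachManifold N]
    [TopologicalSpace P] [AnalyticBanachManifold P] {g : M → N} {h : M → P} {x : M}
    (hg : MapAnalyticAt g x) (hh : MapAnalyticAt h x) :
    MapAnalyticAt (fun x => (g x, h x)) x :=
  ⟨hg.1.prodMk hh.1, hg.2.prod hh.2⟩

theorem MapAnalyticAt.clm_comp {E F G : Type u} [NormedAddCommGroup E] [NormedSpace ℝ E]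
    [NormedAddCommGroup F] [NormedSpace ℝ F] [CompleteSpace F] [NormedAddCommGroup G]
    [NormedSpace ℝ G] [CompleteSpace G] {g : M → F →L[ℝ] G} {f : M → E →L[ℝ] F} {x : M}
    (hg : MapAnalyticAt g x) (hf : MapAnalyticAt f x) :
    MapAnalyticAt (fun x => g x ∘L f x) x := by
  rw [mapAnalyticAt_iff (mem_source x)] at hg hf ⊢
  exact analyticAt_clm_comp hg hf

/-- The differential of a map into a Banach space `Y`, whose tangent spaces are all equal to `Y`. -/
noncomputable def vectorDifferential (f : M → Y) (x : M) : TangentSp x →L[ℝ] Y :=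
  differential f x

theorem hasFDerivAt_comp_chart_symm {i : Idx M} {x : M} (hi : x ∈ (chart i).source)
    (hf : MapAnalyticAt f x) :
    HasFDerivAt (fun y => f ((chart i).symm y))
      (vectorDifferential f x ∘L coordChange i (idxAt x) x) (chart i x) := by
  have hrep : HasFDerivAt (localRep f x) (vectorDifferential f x)
      (chart (idxAt x) ((chart i).symm (chart i x))) := by
    rw [(chart i).left_inv hi]
    exact hf.2.differentiableAt.hasFDerivAt
  refine (hrep.comp (f := fun y => chart (idxAt x) ((chart i).symm y)) _
    (hasFDerivAt_transition hi (mem_source x))).congr_of_eventuallyEq ?_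
  have hsource : ∀ᶠ y in 𝓝 (chart i x), (chart i).symm y ∈ (chart (idxAt x)).source :=
    ((chart i).tendsto_symm hi).eventually ((chart _).open_source.mem_nhds (mem_source x))
  filter_upwards [hsource] with y hy
  exact congrArg f ((chart (idxAt x)).left_inv hy).symm

end Charts

section Tangent

variable {M : Type u} [TopologicalSpace M] [AnalyticBanachManifold M]

theorem mapAnalyticAt_base (p : TangentTotal M) :
    MapAnalyticAt (fun p : TangentTotal M => p.base) p := by
  have hsymm : ContinuousAt (fun z : Model (idxAt p.base) × Model (idxAt p.base) =>
      (chart (idxAt p.base)).symm z.1) (chart (idxAt p) p) :=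
    ((chart (idxAt p.base)).continuousAt_symm
      ((chart (idxAt p.base)).map_source (mem_source p.base))).comp_of_eq
      continuous_fst.continuousAt rfl
  refine ⟨((chart (idxAt p)).symm.continuousAt_iff_continuousAt_comp_right (mem_source p)).2
    hsymm, analyticAt_fst.congr ?_⟩
  filter_upwards [(chart (idxAt p)).open_target.mem_nhds ((chart _).map_source (mem_source p))]
    with z hz
  exact ((chart (idxAt p.base)).right_inv hz.1).symm

variable {Y : Type u} [NormedAddCommGroup Y] [NormedSpace ℝ Y] [CompleteSpace Y]

theorem MapAnalyticAt.comp_base {f : M → Y} {p : TangentTotal M} (hf : MapAnalyticAt f p.base) :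
    MapAnalyticAt (fun p : TangentTotal M => f p.base) p :=
  (mapAnalyticAt_iff (mem_source p)).2
    (((mapAnalyticAt_iff (mem_source p.base)).1 hf).comp_of_eq analyticAt_fst rfl)

theorem analyticAt_tangentChart_symm {Φ : TangentTotal M → Y} (hΦ : ∀ p, MapAnalyticAt Φ p)
    {i : Idx M} {y : Model i} (hy : y ∈ (chart i).target) (v : Model i) :
    AnalyticAt ℝ (fun z : Model i × Model i =>
      Φ ⟨(chart i).symm z.1, coordChange i _ ((chart i).symm z.1) z.2⟩) (y, v) := by
  have hyv : ((y, v) : Model i × Model i) ∈ (chart (M := TangentTotal M) i).target :=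
    ⟨hy, mem_univ v⟩
  have h := (mapAnalyticAt_iff ((chart (M := TangentTotal M) i).map_target hyv)).1 (hΦ _)
  rwa [(chart (M := TangentTotal M) i).right_inv hyv] at h

theorem mapAnalyticAt_vectorDifferential {f : M → Y} (hf : ∀ x, MapAnalyticAt f x)
    (p : TangentTotal M) :
    MapAnalyticAt (fun p : TangentTotal M => vectorDifferential f p.base p.vec) p := by
  set i := idxAt p.base
  have hf' : AnalyticAt ℝ (fun y => f ((chart i).symm y)) (chart i p.base) :=
    (mapAnalyticAt_iff (mem_source p.base)).1 (hf p.base)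
  refine (mapAnalyticAt_iff (mem_source p)).2 ((analyticAt_clm_apply
    (hf'.fderiv.comp_of_eq analyticAt_fst rfl) analyticAt_snd).congr ?_)
  filter_upwards [(chart (idxAt p)).open_target.mem_nhds ((chart _).map_source (mem_source p))]
    with z hz
  have hder := hasFDerivAt_comp_chart_symm ((chart i).map_target hz.1) (hf _)
  rw [(chart i).right_inv hz.1] at hder
  exact DFunLike.congr_fun hder.fderiv z.2

theorem isAnalyticPseudoMetricOn_inner {H : Type u} [NormedAddCommGroup H] [InnerProductSpace ℝ H]
    [CompleteSpace H] {Φ : TangentTotal M → H} (hΦ : ∀ p, MapAnalyticAt Φ p)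
    (hlin : ∀ x : M, IsLinearMap ℝ fun v : TangentSp x => Φ ⟨x, v⟩) :
    IsAnalyticPseudoMetricOn univ
      fun (x : M) (v w : TangentSp x) => inner ℝ (Φ ⟨x, v⟩) (Φ ⟨x, w⟩) where
  linear_left x _ w :=
    ⟨fun v₁ v₂ => by rw [(hlin x).map_add, inner_add_left],
      fun c v => by rw [(hlin x).map_smul, real_inner_smul_left, smul_eq_mul]⟩
  symm x _ v w := real_inner_comm _ _
  nonneg x _ v := real_inner_self_nonneg
  analytic i := by
    rintro z ⟨⟨hz, -⟩, -⟩
    exact analyticAt_inner ((analyticAt_tangentChart_symm hΦ hz z.2.1).comp_of_eq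
      (analyticAt_fst.prod (analyticAt_fst.comp analyticAt_snd)) rfl)
      ((analyticAt_tangentChart_symm hΦ hz z.2.2).comp_of_eq
      (analyticAt_fst.prod (analyticAt_snd.comp analyticAt_snd)) rfl)

end Tangent

section Retraction

variable {M N : Type u} [TopologicalSpace M] [AnalyticBanachManifold M]
  [TopologicalSpace N] [AnalyticBanachManifold N] {f : M → N} {x : M}
  {r : Model (idxAt (f x)) → Model (idxAt x)}

theorem leftInverse_fderiv_differential (hf : MapAnalyticAt f x)
    (hr : DifferentiableAt ℝ r (chart (idxAt (f x)) (f x)))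
    (hrf : ∀ᶠ y in 𝓝 x, r (chart (idxAt (f x)) (f y)) = chart (idxAt x) y) :
    Function.LeftInverse (fderiv ℝ r (chart (idxAt (f x)) (f x))) (differential f x) := by
  have hx : (chart (idxAt x)).symm (chart (idxAt x) x) = x := (chart _).left_inv (mem_source x)
  have hr' : HasFDerivAt r (fderiv ℝ r (chart (idxAt (f x)) (f x)))
      (localRep f x (chart (idxAt x) x)) := by
    rw [localRep, hx]
    exact hr.hasFDerivAt
  have hid : r ∘ localRep f x =ᶠ[𝓝 (chart (idxAt x) x)] id := by
    filter_upwards [(chart (idxAt x)).open_target.mem_nhds ((chart _).map_source (mem_source x)),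
      ((chart (idxAt x)).tendsto_symm (mem_source x)).eventually hrf] with y hy hry
    exact hry.trans ((chart (idxAt x)).right_inv hy)
  have hcomp := (hr'.comp _ hf.2.differentiableAt.hasFDerivAt).congr_of_eventuallyEq hid.symm
  exact fun v => DFunLike.congr_fun (hcomp.unique (hasFDerivAt_id _)) v

theorem comap_nhds_le_of_retraction (hr : ContinuousAt r (chart (idxAt (f x)) (f x)))
    (hrf : ∀ᶠ y in Filter.comap f (𝓝 (f x)),
      y ∈ (chart (idxAt x)).source ∧ r (chart (idxAt (f x)) (f y)) = chart (idxAt x) y) :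
    Filter.comap f (𝓝 (f x)) ≤ 𝓝 x := by
  have hx : r (chart (idxAt (f x)) (f x)) = chart (idxAt x) x := by
    obtain ⟨t, ht, hsub⟩ := hrf
    exact (hsub (show f x ∈ t from mem_of_mem_nhds ht)).2
  have hcoord : Filter.Tendsto (fun y => r (chart (idxAt (f x)) (f y)))
      (Filter.comap f (𝓝 (f x))) (𝓝 (chart (idxAt x) x)) :=
    hx ▸ (hr.comp ((chart _).continuousAt (mem_source (f x)))).tendsto.comp Filter.tendsto_comap
  have hid : Filter.Tendsto id (Filter.comap f (𝓝 (f x))) (𝓝 x) := by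
    refine (((chart (idxAt x)).tendsto_symm (mem_source x)).comp hcoord).congr' ?_
    filter_upwards [hrf] with y hy
    rw [Function.comp_apply, hy.2, (chart _).left_inv hy.1, id]
  exact hid

end Retraction

end AnalyticBanachManifold

section Peirce

variable {R A : Type*} [CommSemiring R] [Ring A] [Algebra R A]

variable (R) in
/-- The Peirce corner `e A f` of a pair of idempotents `e`, `f`, described by equations so that it
makes sense for arbitrary `e` and `f`. -/
def peirceCorner (e f : A) : Submodule R A where
  carrier := {s | e * s = s ∧ s * f = s}
  add_mem' hs ht := ⟨by rw [mul_add, hs.1, ht.1], by rw [add_mul, hs.2, ht.2]⟩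
  zero_mem' := ⟨mul_zero e, zero_mul f⟩
  smul_mem' c s hs := ⟨by rw [mul_smul_comm, hs.1], by rw [smul_mul_assoc, hs.2]⟩

theorem mul_mul_inv_mem_peirceCorner_iff {e₀ e f₀ f : A} {a b : Aˣ}
    (ha : SemiconjBy (a : A) e₀ e) (hb : SemiconjBy (b : A) f₀ f) {s : A} :
    a * s * (b⁻¹ : Aˣ) ∈ peirceCorner R e f ↔ s ∈ peirceCorner R e₀ f₀ := by
  have hleft : e * (a * s * (b⁻¹ : Aˣ)) = a * (e₀ * s) * (b⁻¹ : Aˣ) := by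
    simp only [← mul_assoc, ha.eq]
  have hright : a * s * (b⁻¹ : Aˣ) * f = a * (s * f₀) * (b⁻¹ : Aˣ) := by
    simp only [mul_assoc, hb.units_inv_symm_left.eq]
  change _ ∧ _ ↔ _ ∧ _
  rw [hleft, hright, Units.mul_left_inj, Units.mul_right_inj, Units.mul_left_inj,
    Units.mul_right_inj]

/-- Kato's element `q p + (1 - q) (1 - p)`, which intertwines the idempotents `p` and `q` and is
invertible for `q` near `p`. -/
def intertwiner (p q : A) : A := q * p + (1 - q) * (1 - p)

theorem intertwiner_self {p : A} (hp : IsIdempotentElem p) : intertwiner p p = 1 := by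
  rw [intertwiner, hp.eq, hp.one_sub.eq, add_sub_cancel]

theorem semiconjBy_intertwiner {p q : A} (hp : IsIdempotentElem p)
    (hq : IsIdempotentElem q) : SemiconjBy (intertwiner p q) p q := by
  rw [SemiconjBy, intertwiner, add_mul, mul_add, mul_assoc, mul_assoc, hp.one_sub_mul_self, hp.eq,
    ← mul_assoc, ← mul_assoc, hq.mul_one_sub_self, hq.eq, mul_zero, zero_mul]

end Peirce

section NormedPeirce

variable {𝕜 A : Type*} [NontriviallyNormedField 𝕜] [NormedRing A] [NormedAlgebra 𝕜 A]

theorem closedComplemented_peirceCorner {e f : A} (he : IsIdempotentElem e)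
    (hf : IsIdempotentElem f) : (peirceCorner 𝕜 e f).ClosedComplemented := by
  refine ⟨(ContinuousLinearMap.mulLeftRight 𝕜 A e f).codRestrict _ fun s => ?_, fun s => ?_⟩
  · exact ⟨by simp only [ContinuousLinearMap.mulLeftRight_apply, ← mul_assoc, he.eq],
      by simp only [ContinuousLinearMap.mulLeftRight_apply, mul_assoc, hf.eq]⟩
  · refine Subtype.ext ?_
    change e * s * f = s
    rw [s.2.1, s.2.2]

variable (𝕜) in
/-- The automorphism `s ↦ a s b⁻¹` of the normed space underlying a normed algebra. -/
noncomputable def unitsMulLeftRight (a b : Aˣ) : A ≃L[𝕜] A :=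
  ContinuousLinearEquiv.equivOfInverse (ContinuousLinearMap.mulLeftRight 𝕜 A a (b⁻¹ : Aˣ))
    (ContinuousLinearMap.mulLeftRight 𝕜 A (a⁻¹ : Aˣ) b)
    (fun s => by simp [mul_assoc]) (fun s => by simp [mul_assoc])

theorem analyticAt_mulLeftRight {V : Type*} [NormedAddCommGroup V] [NormedSpace 𝕜 V] {f g : V → A}
    {z : V} (hf : AnalyticAt 𝕜 f z) (hg : AnalyticAt 𝕜 g z) :
    AnalyticAt 𝕜 (fun z => ContinuousLinearMap.mulLeftRight 𝕜 A (f z) (g z)) z := by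
  have hleft : AnalyticAt 𝕜 (fun z => ContinuousLinearMap.mul 𝕜 A (f z)) z :=
    ((ContinuousLinearMap.mul 𝕜 A).analyticAt _).comp hf
  have hright : AnalyticAt 𝕜 (fun z => (ContinuousLinearMap.mul 𝕜 A).flip (g z)) z :=
    ((ContinuousLinearMap.mul 𝕜 A).flip.analyticAt _).comp hg
  exact analyticAt_clm_comp hright hleft

end NormedPeirce

namespace AnalyticBanachManifold

variable {M : Type u} [TopologicalSpace M] [AnalyticBanachManifold M] {A : Type u} [NormedRing A]
  [NormedAlgebra ℝ A] [CompleteSpace A] {e f : M → A} {x : M}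

theorem MapAnalyticAt.intertwiner (p : A) (he : MapAnalyticAt e x) :
    MapAnalyticAt (fun x => intertwiner p (e x)) x := by
  rw [mapAnalyticAt_iff (mem_source x)] at he ⊢
  exact (he.mul analyticAt_const).add ((analyticAt_const.sub he).mul analyticAt_const)

theorem MapAnalyticAt.mulLeftRight_inverse (he : MapAnalyticAt e x) (hf : MapAnalyticAt f x)
    (hfx : IsUnit (f x)) : MapAnalyticAt
      (fun x => ContinuousLinearMap.mulLeftRight ℝ A (e x) (Ring.inverse (f x))) x := by
  rw [mapAnalyticAt_iff (mem_source x)] at he hf ⊢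
  have hinv : AnalyticAt ℝ (fun y => Ring.inverse (f ((chart (idxAt x)).symm y)))
      (chart (idxAt x) x) :=
    (analyticAt_inverse hfx.unit).comp_of_eq hf (by rw [(chart _).left_inv (mem_source x)]; rfl)
  exact analyticAt_mulLeftRight he hinv

open Classical in
theorem isAnalyticSubbundle_peirceCorner (he : ∀ x, MapAnalyticAt e x)
    (hf : ∀ x, MapAnalyticAt f x) (he' : ∀ x, IsIdempotentElem (e x))
    (hf' : ∀ x, IsIdempotentElem (f x)) :
    IsAnalyticSubbundle fun x => peirceCorner ℝ (e x) (f x) := by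
  intro x₀
  set a : M → A := fun x => intertwiner (e x₀) (e x)
  set b : M → A := fun x => intertwiner (f x₀) (f x)
  have ha : ∀ x, MapAnalyticAt a x := fun x => (he x).intertwiner _
  have hb : ∀ x, MapAnalyticAt b x := fun x => (hf x).intertwiner _
  set U : Set M := {x | IsUnit (a x)} ∩ {x | IsUnit (b x)}
  have hU : IsOpen U :=
    (Units.isOpen.preimage (continuous_iff_continuousAt.2 fun x => (ha x).1)).inter
      (Units.isOpen.preimage (continuous_iff_continuousAt.2 fun x => (hb x).1))
  have hx₀ : x₀ ∈ U := by
    constructor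
    · simp [a, intertwiner_self (he' x₀)]
    · simp [b, intertwiner_self (hf' x₀)]
  let Θ : M → A ≃L[ℝ] A := fun x =>
    if hx : x ∈ U then unitsMulLeftRight ℝ hx.1.unit hx.2.unit else .refl ℝ A
  have hΘ : ∀ x ∈ U, (Θ x : A →L[ℝ] A) =
      ContinuousLinearMap.mulLeftRight ℝ A (a x) (Ring.inverse (b x)) := by
    intro x hx
    simp only [Θ, dif_pos hx, Ring.inverse_of_isUnit hx.2]
    rfl
  refine ⟨closedComplemented_peirceCorner (he' x₀) (hf' x₀), U, hU, hx₀, Θ, fun x hx => ?_,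
    fun x hx s => ?_⟩
  · exact ((ha x).mulLeftRight_inverse (hb x) hx.2).congr_of_eventuallyEq
      (Filter.mem_of_superset (hU.mem_nhds hx) hΘ)
  · simp only [Θ, dif_pos hx]
    exact mul_mul_inv_mem_peirceCorner_iff (semiconjBy_intertwiner (he' x₀) (he' x))
      (semiconjBy_intertwiner (hf' x₀) (hf' x))

end AnalyticBanachManifold

section KerzmanStein

variable {𝕜 H : Type*} [RCLike 𝕜] [NormedAddCommGroup H] [InnerProductSpace 𝕜 H] [CompleteSpace H]

theorem isUnit_one_add_of_star_eq_neg {A : H →L[𝕜] H} (hA : star A = -A) : IsUnit (1 + A) := by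
  refine ContinuousLinearMap.isUnit_of_forall_le_norm_inner_map (1 + A) one_pos fun x => ?_
  have hskew : RCLike.re (inner 𝕜 (A x) x) = 0 := by
    have h : inner 𝕜 (A x) x = -inner 𝕜 x (A x) := by
      rw [← ContinuousLinearMap.adjoint_inner_right, ← ContinuousLinearMap.star_eq_adjoint, hA]
      exact inner_neg_right _ _
    have hre := congrArg RCLike.re h
    rw [map_neg, inner_re_symm] at hre
    rw [inner_re_symm]
    linarith
  have hre : RCLike.re (inner 𝕜 ((1 + A) x) x) = ‖x‖ ^ 2 := by
    rw [add_apply, one_apply_eq_self, inner_add_left, map_add,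
      hskew, add_zero, inner_self_eq_norm_sq]
  rw [NNReal.coe_one, mul_one, ← hre]
  exact RCLike.re_le_norm _

theorem isUnit_one_add_sub_star (Q : H →L[𝕜] H) : IsUnit (1 + (Q - star Q)) :=
  isUnit_one_add_of_star_eq_neg (by rw [star_sub, star_star, neg_sub])

theorem starProjection_eq_mul_inverse {U : Submodule 𝕜 H} [U.HasOrthogonalProjection]
    {Q : H →L[𝕜] H} (hmem : ∀ x, Q x ∈ U) (hfix : ∀ x ∈ U, Q x = x) :
    U.starProjection = Q * Ring.inverse (1 + (Q - star Q)) := by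
  have hPQ : U.starProjection * Q = Q :=
    ContinuousLinearMap.ext fun x => Submodule.starProjection_eq_self_iff.2 (hmem x)
  have hQP : Q * U.starProjection = U.starProjection :=
    ContinuousLinearMap.ext fun x => hfix _ (U.starProjection_apply_mem x)
  have hPQ' : U.starProjection * star Q = U.starProjection := by
    have h := congrArg star hQP
    rwa [star_mul, (isSelfAdjoint_starProjection U).star_eq] at h
  rw [Ring.eq_mul_inverse_iff_mul_eq _ _ _ (isUnit_one_add_sub_star Q), mul_add, mul_sub, mul_one,
    hPQ, hPQ', add_sub_cancel]

end KerzmanStein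

theorem analyticAt_starProjection {V H : Type*} [NormedAddCommGroup V] [NormedSpace ℝ V]
    [NormedAddCommGroup H] [InnerProductSpace ℝ H] [CompleteSpace H] {U : V → Submodule ℝ H}
    [∀ z, (U z).HasOrthogonalProjection] {Q : V → H →L[ℝ] H} {z : V} (hQ : AnalyticAt ℝ Q z)
    (hmem : ∀ z x, Q z x ∈ U z) (hfix : ∀ z, ∀ x ∈ U z, Q z x = x) :
    AnalyticAt ℝ (fun z => (U z).starProjection) z := by
  have hstar : AnalyticAt ℝ (fun z => star (Q z)) z :=
    ((starL' ℝ : (H →L[ℝ] H) ≃L[ℝ] _).toContinuousLinearMap.analyticAt _).comp hQ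
  have hinv : AnalyticAt ℝ (fun z => Ring.inverse (1 + (Q z - star (Q z)))) z :=
    (analyticAt_inverse (isUnit_one_add_sub_star (Q z)).unit).comp_of_eq
      (analyticAt_const.add (hQ.sub hstar)) rfl
  simp only [fun z => starProjection_eq_mul_inverse (hmem z) (hfix z)]
  exact hQ.mul hinv

theorem sq_opNorm_le_sum_sq_norm {ι V W : Type*} [Fintype ι] [NormedAddCommGroup V]
    [InnerProductSpace ℝ V] [NormedAddCommGroup W] [NormedSpace ℝ W] (b : OrthonormalBasis ι ℝ V)
    (S : V →L[ℝ] W) : ‖S‖ ^ 2 ≤ ∑ k, ‖S (b k)‖ ^ 2 := by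
  have hsum : 0 ≤ ∑ k, ‖S (b k)‖ ^ 2 := Finset.sum_nonneg fun k _ => sq_nonneg _
  rw [← Real.le_sqrt (norm_nonneg _) hsum]
  refine S.opNorm_le_bound (Real.sqrt_nonneg _) fun v => ?_
  calc ‖S v‖ = ‖∑ k, inner ℝ (b k) v • S (b k)‖ := by
        conv_lhs => rw [← b.sum_repr' v, map_sum]
        simp only [map_smul]
    _ ≤ ∑ k, ‖S (b k)‖ * ‖inner ℝ (b k) v‖ :=
        (norm_sum_le _ _).trans_eq (Finset.sum_congr rfl fun k _ => by rw [norm_smul, mul_comm])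
    _ ≤ √(∑ k, ‖S (b k)‖ ^ 2) * √(∑ k, ‖inner ℝ (b k) v‖ ^ 2) :=
        Real.sum_mul_le_sqrt_mul_sqrt _ _ _
    _ = √(∑ k, ‖S (b k)‖ ^ 2) * ‖v‖ := by
        rw [b.sum_sq_norm_inner_right, Real.sqrt_sq (norm_nonneg v)]

theorem analyticAt_trace {𝕜 Z W : Type*} [NontriviallyNormedField 𝕜] [CompleteSpace 𝕜]
    [NormedAddCommGroup Z] [NormedSpace 𝕜 Z] [NormedAddCommGroup W] [NormedSpace 𝕜 W]
    [FiniteDimensional 𝕜 W] {A : Z → W →L[𝕜] W} {z : Z} (hA : AnalyticAt 𝕜 A z) :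
    AnalyticAt 𝕜 (fun z => LinearMap.trace 𝕜 W (A z).toLinearMap) z :=
  ((LinearMap.toContinuousLinearMap
    (LinearMap.trace 𝕜 W ∘ₗ ContinuousLinearMap.coeLM 𝕜)).analyticAt _).comp hA

namespace Grassmannian

open Submodule AnalyticBanachManifold

section GraphMap

variable {X : Type u} [NormedAddCommGroup X] [NormedSpace ℝ X]

theorem analyticAt_graphMap_self (E F : Submodule ℝ X) (T : E →L[ℝ] F) :
    AnalyticAt ℝ (graphMap E F) T :=
  analyticAt_graphMap E F (.id ℝ X) T

theorem coord_self {E F : Submodule ℝ X} (h : IsTopCompl E F) : coord E F E = 0 := by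
  rw [coord, dif_pos h, neg_eq_zero]
  ext y : 1
  exact projectionOntoL_apply_right h.symm y

/-- When `S = extend E V` on a Hilbert space, `E` the graph of `T`, these are the coordinates of the
tangent vector `V` in the chart given by `(E₀, F₀)`: the operator `q - T p` built from the
projections `p` and `q` of `E₀ ⊕ F₀` is the projection onto `F₀` along `E`. -/
noncomputable def coordOfOperator {E₀ F₀ : Submodule ℝ X} (h : IsTopCompl E₀ F₀) (T : E₀ →L[ℝ] F₀)
    (S : X →L[ℝ] X) : E₀ →L[ℝ] F₀ :=
  (F₀.projectionOntoL E₀ h.symm - T ∘L E₀.projectionOntoL F₀ h) ∘L S ∘L graphMap E₀ F₀ T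

theorem analyticAt_coordOfOperator {E₀ F₀ : Submodule ℝ X} (h : IsTopCompl E₀ F₀)
    (z : (E₀ →L[ℝ] F₀) × (X →L[ℝ] X)) :
    AnalyticAt ℝ (fun z : (E₀ →L[ℝ] F₀) × (X →L[ℝ] X) => coordOfOperator h z.1 z.2) z :=
  analyticAt_clm_comp
    (analyticAt_const.sub (analyticAt_clm_comp analyticAt_fst analyticAt_const))
    (analyticAt_clm_comp analyticAt_snd
      ((analyticAt_graphMap_self E₀ F₀ z.1).comp_of_eq analyticAt_fst rfl))

theorem coordOfOperator_eq {E₀ F₀ : Submodule ℝ X} (h : IsTopCompl E₀ F₀) {T V : E₀ →L[ℝ] F₀}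
    {S : X →L[ℝ] X} (hS : ∀ y, S (graphMap E₀ F₀ T y) - V y ∈ (graphMap E₀ F₀ T).range) :
    coordOfOperator h T S = V := by
  ext y : 1
  obtain ⟨y', hy' : graphMap E₀ F₀ T y' = _⟩ := hS y
  change F₀.projectionOntoL E₀ h.symm (S (graphMap E₀ F₀ T y)) -
    T (E₀.projectionOntoL F₀ h (S (graphMap E₀ F₀ T y))) = V y
  rw [sub_eq_iff_eq_add.1 hy'.symm, map_add, map_add, proj_graphMap, proj_graphMap' h,
    projectionOntoL_apply_left, projectionOntoL_apply_right, add_zero, add_sub_cancel_left]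

/-- The left inverse `(E, S) ↦ (E, T)` of the map `(E, T) ↦ (E, T P_E)` of a Hilbert space, in the
charts given by `i`. -/
noncomputable def chartRetraction (i : ComplPair X)
    (z : (i.1.1.space →L[ℝ] i.1.2.space) × (X →L[ℝ] X)) :
    (i.1.1.space →L[ℝ] i.1.2.space) × (i.1.1.space →L[ℝ] i.1.2.space) :=
  (z.1, coordOfOperator i.2 z.1 z.2)

theorem analyticAt_chartRetraction (i : ComplPair X)
    (z : (i.1.1.space →L[ℝ] i.1.2.space) × (X →L[ℝ] X)) : AnalyticAt ℝ (chartRetraction i) z :=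
  analyticAt_fst.prod (analyticAt_coordOfOperator i.2 z)

theorem finiteDimensional_graph_iff (i : ComplPair X) (T : i.1.1.space →L[ℝ] i.1.2.space) :
    FiniteDimensional ℝ (graph i.1.1 i.1.2 i.2 T).space ↔ FiniteDimensional ℝ i.1.1.space :=
  (Module.Finite.equiv_iff (LinearEquiv.ofInjective
    (graphMap i.1.1.space i.1.2.space T).toLinearMap
    (Function.LeftInverse.injective (proj_graphMap i.2 T)))).symm

theorem analyticAt_trace_comp_graphMap {Z : Type*} [NormedAddCommGroup Z] [NormedSpace ℝ Z]
    (i : ComplPair X) [FiniteDimensional ℝ i.1.1.space] {A : Z → X →L[ℝ] X}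
    {T : Z → i.1.1.space →L[ℝ] i.1.2.space} {z : Z} (hA : AnalyticAt ℝ A z)
    (hT : AnalyticAt ℝ T z) :
    AnalyticAt ℝ (fun z => LinearMap.trace ℝ i.1.1.space
      (i.1.1.space.projectionOntoL i.1.2.space i.2 ∘L A z ∘L
        graphMap i.1.1.space i.1.2.space (T z)).toLinearMap) z :=
  analyticAt_trace (analyticAt_clm_comp analyticAt_const
    (analyticAt_clm_comp hA ((analyticAt_graphMap_self _ _ (T z)).comp hT)))

end GraphMap

section FinRankTrace

variable {K : Type u} [NormedAddCommGroup K] [InnerProductSpace ℝ K]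

theorem finRankTrace_comp {W : Type*} [NormedAddCommGroup W] [NormedSpace ℝ W]
    [FiniteDimensional ℝ W] (u : W →L[ℝ] K) (v : K →L[ℝ] W) :
    finRankTrace (u ∘L v) = LinearMap.trace ℝ W (v ∘L u).toLinearMap := by
  have hle : (u ∘L v).range ≤ u.range := by
    rintro _ ⟨x, rfl⟩
    exact ⟨v x, rfl⟩
  have : FiniteDimensional ℝ (u ∘L v).range := finiteDimensional_of_le hle
  let v' : u.range →ₗ[ℝ] W := v.toLinearMap ∘ₗ u.range.subtype
  let r : u.range →ₗ[ℝ] (u ∘L v).range :=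
    (u ∘L v).toLinearMap.rangeRestrict ∘ₗ u.range.subtype
  calc finRankTrace (u ∘L v)
    _ = LinearMap.trace ℝ _ (r ∘ₗ inclusion hle) := rfl
    _ = LinearMap.trace ℝ _ (inclusion hle ∘ₗ r) := LinearMap.trace_comp_comm' _ _
    _ = LinearMap.trace ℝ _ (u.toLinearMap.rangeRestrict ∘ₗ v') := rfl
    _ = LinearMap.trace ℝ _ (v' ∘ₗ u.toLinearMap.rangeRestrict) := LinearMap.trace_comp_comm' _ _

theorem finRankTrace_eq_trace_of_leftInvOn {W : Type*} [NormedAddCommGroup W] [NormedSpace ℝ W]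
    [FiniteDimensional ℝ W] {A : K →L[ℝ] K} {u : W →L[ℝ] K} {v : K →L[ℝ] W}
    (huv : LeftInvOn u v A.range) :
    finRankTrace A = LinearMap.trace ℝ W (v ∘L A ∘L u).toLinearMap := by
  have hA : A = u ∘L (v ∘L A) := ContinuousLinearMap.ext fun x => (huv ⟨x, rfl⟩).symm
  conv_lhs => rw [hA]
  rw [finRankTrace_comp, ContinuousLinearMap.comp_assoc]

end FinRankTrace

section OrthogonalProjection

variable {K : Type u} [NormedAddCommGroup K] [InnerProductSpace ℝ K] [CompleteSpace K]

section Graph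

variable {E F : Grassmannian K} (h : IsTopCompl E.space F.space) (T : E.space →L[ℝ] F.space)

theorem analyticAt_starProjection_graph :
    AnalyticAt ℝ (fun T => (graph E F h T).space.starProjection) T := by
  refine analyticAt_starProjection (Q := fun T =>
    graphMap E.space F.space T ∘L E.space.projectionOntoL F.space h)
    (analyticAt_clm_comp (analyticAt_graphMap_self _ _ T) analyticAt_const) ?_ ?_
  · exact fun T x => ⟨_, rfl⟩
  · rintro T _ ⟨y, rfl⟩
    exact congrArg (graphMap _ _ T) (proj_graphMap h T y)

theorem fderiv_starProjection_graph_apply_graphMap (V : E.space →L[ℝ] F.space) (y : E.space) :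
    fderiv ℝ (fun T => (graph E F h T).space.starProjection) T V (graphMap E.space F.space T y) =
      V y - (graph E F h T).space.starProjection (V y) := by
  have hgraph : HasFDerivAt (fun T => graphMap E.space F.space T y)
      ((ContinuousLinearMap.compL ℝ E.space F.space K F.space.subtypeL).flip y) T :=
    ((ContinuousLinearMap.compL ℝ E.space F.space K F.space.subtypeL).flip y).hasFDerivAt.const_add
      (y : K)
  have hproj := (analyticAt_starProjection_graph h T).differentiableAt.hasFDerivAt.clm_apply hgraph
  have hfix : (fun T => (graph E F h T).space.starProjection (graphMap E.space F.space T y)) =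
      fun T => graphMap E.space F.space T y :=
    funext fun T => starProjection_eq_self_iff.2 ⟨y, rfl⟩
  rw [hfix] at hproj
  exact eq_sub_of_add_eq' (DFunLike.congr_fun (hproj.unique hgraph) V)

end Graph

theorem mapAnalyticAt_starProjection (E : Grassmannian K) :
    MapAnalyticAt (fun E : Grassmannian K => E.space.starProjection) E :=
  (mapAnalyticAt_iff (mem_source E)).2 (analyticAt_starProjection_graph (idxAt E).2 _)

theorem vectorDifferential_starProjection_apply (E : Grassmannian K)
    (V : E.space →L[ℝ] E.perp.space) (y : E.space) :
    vectorDifferential (fun E : Grassmannian K => E.space.starProjection) E V y = V y := by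
  have hcompl : IsTopCompl E.space E.perp.space := isTopCompl_orthogonal E.space
  have hzero : chart (idxAt E) E = 0 := coord_self hcompl
  have hgraph : graph E E.perp hcompl 0 = E := by
    rw [← hzero]
    exact (chart (idxAt E)).left_inv (mem_source E)
  have hderiv : vectorDifferential (fun E : Grassmannian K => E.space.starProjection) E =
      fderiv ℝ (fun T => (graph E E.perp hcompl T).space.starProjection) 0 := by
    rw [← hzero]
    rfl
  have hy : graphMap E.space E.perp.space 0 y = y := by simp [graphMap]
  have h := fderiv_starProjection_graph_apply_graphMap hcompl 0 V y
  rw [hgraph, hy, (starProjection_apply_eq_zero_iff E.space).2 (V y).2, sub_zero] at h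
  rw [hderiv, h]

theorem extend_eq_vectorDifferential_comp (E : Grassmannian K) (V : E.space →L[ℝ] E.spaceᗮ) :
    extend E V = vectorDifferential (fun E : Grassmannian K => E.space.starProjection) E V ∘L
      E.space.starProjection :=
  ContinuousLinearMap.ext fun x =>
    (vectorDifferential_starProjection_apply E V (E.space.orthogonalProjectionOnto x)).symm

theorem mapAnalyticAt_extend (p : TangentTotal (Grassmannian K)) :
    MapAnalyticAt (fun p : TangentTotal (Grassmannian K) => extend p.base p.vec) p := by
  have h := (mapAnalyticAt_vectorDifferential mapAnalyticAt_starProjection p).clm_comp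
    (mapAnalyticAt_starProjection p.base).comp_base
  exact h.congr_of_eventuallyEq (.of_forall fun p => extend_eq_vectorDifferential_comp _ _)

theorem extend_apply (E : Grassmannian K) (T : E.space →L[ℝ] E.spaceᗮ) (y : E.space) :
    extend E T y = T y := by
  simp [extend]

theorem coordOfOperator_extend {E : Grassmannian K} {i : ComplPair K}
    (hE : E ∈ (grChart i).source) (v : E.space →L[ℝ] E.perp.space) :
    coordOfOperator i.2 (grChart i E) (extend E v) =
      coordChange (M := Grassmannian K) (idxAt E) i E v := by
  set T : i.1.1.space →L[ℝ] i.1.2.space := grChart i E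
  set V : i.1.1.space →L[ℝ] i.1.2.space := coordChange (M := Grassmannian K) (idxAt E) i E v
  have hgraph : graph i.1.1 i.1.2 i.2 T = E := (grChart i).left_inv hE
  have hrange : (graphMap i.1.1.space i.1.2.space T).range = E.space := congrArg space hgraph
  have hderiv : fderiv ℝ (fun T => (graph i.1.1 i.1.2 i.2 T).space.starProjection) T V =
      vectorDifferential (fun E : Grassmannian K => E.space.starProjection) E v := by
    have hchart := hasFDerivAt_comp_chart_symm (i := i) hE (mapAnalyticAt_starProjection E)
    refine (DFunLike.congr_fun hchart.fderiv V).trans (congrArg (vectorDifferential _ E) ?_)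
    exact (coordChange_coordChange (M := Grassmannian K) (mem_source E) hE (mem_source E) v).trans
      (coordChange_self (mem_source E) v)
  refine coordOfOperator_eq i.2 fun y => ?_
  have hy : E.space.starProjection (graphMap i.1.1.space i.1.2.space T y) =
      graphMap i.1.1.space i.1.2.space T y :=
    starProjection_eq_self_iff.2 (hrange ▸ ⟨y, rfl⟩)
  have hext : extend E v (graphMap i.1.1.space i.1.2.space T y) =
      V y - E.space.starProjection (V y) := by
    refine (DFunLike.congr_fun (extend_eq_vectorDifferential_comp E v) _).trans ?_
    rw [ContinuousLinearMap.comp_apply, hy, ← hderiv,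
      fderiv_starProjection_graph_apply_graphMap, hgraph]
  rw [hext, hrange, sub_sub_cancel_left]
  exact neg_mem (E.space.starProjection_apply_mem _)

section TangentEmbedding

theorem isLinearMap_extend (E : Grassmannian K) :
    IsLinearMap ℝ (fun T : E.space →L[ℝ] E.spaceᗮ => extend E T) where
  map_add S T := by ext x; simp [extend]
  map_smul c T := by ext x; simp [extend]

theorem extend_injective (E : Grassmannian K) : Function.Injective (extend E) := by
  intro S T h
  ext y
  rw [← extend_apply, ← extend_apply, h]

theorem tangentEmbedding_injective : Function.Injective (tangentEmbedding K) := by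
  rintro ⟨E, S⟩ ⟨E', T⟩ h
  obtain rfl : E = E' := congrArg Prod.fst h
  exact congrArg (TangentTotal.mk E) (extend_injective E (congrArg Prod.snd h))

theorem fibre_eq_peirceCorner (E : Grassmannian K) :
    E.fibre = peirceCorner ℝ (1 - E.space.starProjection) E.space.starProjection := by
  ext S
  have hright : (∀ x ∈ E.spaceᗮ, S x = 0) ↔ S * E.space.starProjection = S := by
    constructor
    · intro h
      ext x
      have hx := h _ (E.space.sub_starProjection_mem_orthogonal x)
      rw [map_sub, sub_eq_zero] at hx
      exact hx.symm
    · intro h x hx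
      rw [← h, mul_apply_eq_comp, (starProjection_apply_eq_zero_iff _).2 hx, map_zero]
  have hleft : (∀ x, S x ∈ E.spaceᗮ) ↔ (1 - E.space.starProjection) * S = S := by
    rw [sub_mul, one_mul, sub_eq_self, ContinuousLinearMap.ext_iff]
    exact forall_congr' fun x => (starProjection_apply_eq_zero_iff _).symm
  exact (and_congr hright hleft).trans and_comm

theorem extend_mem_fibre (E : Grassmannian K) (T : E.space →L[ℝ] E.spaceᗮ) :
    extend E T ∈ E.fibre := by
  refine ⟨fun x hx => ?_, fun x => (T _).2⟩
  simp [extend, orthogonalProjectionOnto_eq_zero_iff.2 hx]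

theorem range_tangentEmbedding : range (tangentEmbedding K) = {p | p.2 ∈ fibre p.1} := by
  ext ⟨E, S⟩
  constructor
  · rintro ⟨p, hp⟩
    rw [← hp]
    exact extend_mem_fibre p.base p.vec
  · intro hS
    refine ⟨⟨E, (S ∘L E.space.subtypeL).codRestrict E.spaceᗮ fun x => hS.2 x⟩, Prod.ext rfl ?_⟩
    rw [mem_ofPred_eq, fibre_eq_peirceCorner] at hS
    exact hS.2

theorem isAnalyticSubbundle_fibre : IsAnalyticSubbundle fun E : Grassmannian K => E.fibre := by
  have hcompl : ∀ E : Grassmannian K,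
      MapAnalyticAt (fun E : Grassmannian K => 1 - E.space.starProjection) E := fun E =>
    (mapAnalyticAt_iff (mem_source E)).2
      (analyticAt_const.sub ((mapAnalyticAt_iff (mem_source E)).1 (mapAnalyticAt_starProjection E)))
  simp only [fibre_eq_peirceCorner]
  exact isAnalyticSubbundle_peirceCorner hcompl mapAnalyticAt_starProjection
    (fun E => (isIdempotentElem_starProjection E.space).one_sub)
    (fun E => isIdempotentElem_starProjection E.space)

theorem mapAnalyticAt_tangentEmbedding (p : TangentTotal (Grassmannian K)) :
    MapAnalyticAt (tangentEmbedding K) p :=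
  (mapAnalyticAt_base p).prodMk (mapAnalyticAt_extend p)

theorem chartRetraction_tangentEmbedding {i : ComplPair K} {p : TangentTotal (Grassmannian K)}
    (hp : p.base ∈ (grChart i).source) :
    chartRetraction i (grChart i p.base, extend p.base p.vec) = tangentChart i p :=
  Prod.ext rfl (coordOfOperator_extend hp p.vec)

theorem eventually_chartRetraction_tangentEmbedding (p : TangentTotal (Grassmannian K)) :
    ∀ᶠ q in Filter.comap (tangentEmbedding K) (𝓝 (tangentEmbedding K p)),
      q ∈ (chart (idxAt p)).source ∧ chartRetraction (idxAt p.base)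
        (chart (idxAt (tangentEmbedding K p)) (tangentEmbedding K q)) = chart (idxAt p) q := by
  have hbase : Filter.Tendsto (fun q : TangentTotal (Grassmannian K) => q.base)
      (Filter.comap (tangentEmbedding K) (𝓝 (tangentEmbedding K p))) (𝓝 p.base) :=
    continuousAt_fst.tendsto.comp Filter.tendsto_comap
  filter_upwards [hbase ((chart (idxAt p.base)).open_source.mem_nhds (mem_source p.base))] with q hq
  exact ⟨hq, chartRetraction_tangentEmbedding hq⟩

theorem isAnalyticImmersion_tangentEmbedding : IsAnalyticImmersion (tangentEmbedding K) := by
  intro p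
  have hf := mapAnalyticAt_tangentEmbedding p
  have hleft := leftInverse_fderiv_differential hf
    (analyticAt_chartRetraction (idxAt p.base) _).differentiableAt
    (hf.1.tendsto.le_comap ((eventually_chartRetraction_tangentEmbedding p).mono fun _ h => h.2))
  exact ⟨hf, hleft.injective,
    ContinuousLinearMap.closedComplemented_range_of_leftInverse _ _ hleft⟩

theorem isEmbedding_tangentEmbedding : IsEmbedding (tangentEmbedding K) where
  injective := tangentEmbedding_injective
  toIsInducing := isInducing_iff_nhds.2 fun p =>
    le_antisymm (mapAnalyticAt_tangentEmbedding p).1.tendsto.le_comap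
      (comap_nhds_le_of_retraction
        (analyticAt_chartRetraction (idxAt p.base) _).continuousAt
        (eventually_chartRetraction_tangentEmbedding p))

end TangentEmbedding

theorem adjoint_extend (E : Grassmannian K) (T : E.space →L[ℝ] E.spaceᗮ) :
    ContinuousLinearMap.adjoint (extend E T) = adjointExtend E T := by
  rw [extend, adjointExtend, ContinuousLinearMap.adjoint_comp, ContinuousLinearMap.adjoint_comp,
    adjoint_subtypeL, adjoint_orthogonalProjectionOnto]
  rfl

theorem opMetric_eq (E : Grassmannian K) (S T : E.space →L[ℝ] E.spaceᗮ) :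
    opMetric E S T = star (extend E S) * extend E T := by
  rw [opMetric, ← adjoint_extend, ← adjoint_extend, ContinuousLinearMap.adjoint_adjoint]
  rfl

theorem range_opMetric_le (E : Grassmannian K) (S T : E.space →L[ℝ] E.spaceᗮ) :
    (opMetric E S T).range ≤ E.space := by
  rintro _ ⟨x, rfl⟩
  exact Subtype.prop (p := fun x : K => x ∈ E.space) _

section Separating

theorem vecMetric_eq_inner (x : K) (E : Grassmannian K) (S T : E.space →L[ℝ] E.spaceᗮ) :
    vecMetric x E S T = inner ℝ (extend E S x) (extend E T x) := by
  refine (congrArg (fun A : K →L[ℝ] K => inner ℝ (A x) x) (opMetric_eq E S T)).trans ?_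
  rw [mul_apply_eq_comp, ContinuousLinearMap.star_eq_adjoint,
    ContinuousLinearMap.adjoint_inner_left, real_inner_comm]

theorem isAnalyticPseudoMetricOn_vecMetric (x : K) :
    IsAnalyticPseudoMetricOn univ (vecMetric x) := by
  have hΦ : ∀ p : TangentTotal (Grassmannian K),
      MapAnalyticAt (fun p : TangentTotal (Grassmannian K) => extend p.base p.vec x) p := fun p =>
    (mapAnalyticAt_iff (mem_source p)).2
      (analyticAt_clm_apply ((mapAnalyticAt_iff (mem_source p)).1 (mapAnalyticAt_extend p))
        analyticAt_const)
  have hlin : ∀ E : Grassmannian K, IsLinearMap ℝ fun T : TangentSp E => extend E T x := fun E =>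
    ⟨fun S T => DFunLike.congr_fun ((isLinearMap_extend E).map_add S T) x,
      fun c T => DFunLike.congr_fun ((isLinearMap_extend E).map_smul c T) x⟩
  convert isAnalyticPseudoMetricOn_inner hΦ hlin using 1
  funext E S T
  exact vecMetric_eq_inner x E S T

theorem isSeparating_of_denseRange {ι : Type*} {x : ι → K} (hx : DenseRange x) :
    IsSeparating fun a => vecMetric (x a) := by
  intro E T hT
  refine extend_injective E (Eq.trans (DFunLike.coe_injective ?_)
    (isLinearMap_extend E).map_zero.symm)
  refine hx.equalizer (extend E T).continuous continuous_const (funext fun a => ?_)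
  exact inner_self_eq_zero.1 ((vecMetric_eq_inner (x a) E T T).symm.trans (hT a))

end Separating

section FinitePart

theorem isOpen_finPart : IsOpen (finPart K) := by
  intro (i : ComplPair K)
  have h : (grChart i).target ∩ (grChart i).symm ⁻¹' finPart K =
      {_T | FiniteDimensional ℝ i.1.1.space} :=
    ext fun T => (and_iff_right (mem_univ T)).trans (finiteDimensional_graph_iff i T)
  exact h ▸ isOpen_const

theorem finiteDimensional_range_opMetric {E : Grassmannian K} (hE : E ∈ finPart K)
    (S T : E.space →L[ℝ] E.spaceᗮ) : FiniteDimensional ℝ (opMetric E S T).range :=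
  have : FiniteDimensional ℝ E.space := hE
  finiteDimensional_of_le (range_opMetric_le E S T)

theorem traceMetric_eq_sum_inner {ι : Type*} [Fintype ι] {E : Grassmannian K}
    (b : OrthonormalBasis ι ℝ E.space) (S T : E.space →L[ℝ] E.spaceᗮ) :
    traceMetric E S T = ∑ k, inner ℝ (S (b k)) (T (b k)) := by
  have : FiniteDimensional ℝ E.space := b.toBasis.finiteDimensional_of_finite
  have huv : LeftInvOn E.space.subtypeL E.space.orthogonalProjectionOnto (opMetric E S T).range :=
    fun x hx => starProjection_eq_self_iff.2 (range_opMetric_le E S T hx)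
  refine (finRankTrace_eq_trace_of_leftInvOn huv).trans ?_
  rw [LinearMap.trace_eq_sum_inner _ b]
  refine Finset.sum_congr rfl fun k _ => ?_
  calc inner ℝ (b k) (E.space.orthogonalProjectionOnto (opMetric E S T (b k)))
    _ = inner ℝ (b k : K) (opMetric E S T (b k)) :=
      inner_orthogonalProjectionOnto_eq_of_mem_left _ _
    _ = inner ℝ (extend E S (b k)) (extend E T (b k)) := by
      rw [opMetric_eq, mul_apply_eq_comp, ContinuousLinearMap.star_eq_adjoint,
        ContinuousLinearMap.adjoint_inner_right]
    _ = inner ℝ (S (b k)) (T (b k)) := by rw [extend_apply, extend_apply, coe_inner]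

theorem traceMetric_eq_trace_comp_graphMap {E : Grassmannian K} {i : ComplPair K}
    [FiniteDimensional ℝ i.1.1.space] (hE : E ∈ (grChart i).source)
    (S T : E.space →L[ℝ] E.spaceᗮ) :
    traceMetric E S T = LinearMap.trace ℝ i.1.1.space
      (i.1.1.space.projectionOntoL i.1.2.space i.2 ∘L (star (extend E S) * extend E T) ∘L
        graphMap i.1.1.space i.1.2.space (grChart i E)).toLinearMap := by
  have hgraph : (graphMap i.1.1.space i.1.2.space (grChart i E)).range = E.space :=
    congrArg space ((grChart i).left_inv hE)
  rw [← opMetric_eq]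
  refine finRankTrace_eq_trace_of_leftInvOn fun x hx => ?_
  obtain ⟨y, rfl⟩ := hgraph ▸ range_opMetric_le E S T hx
  exact congrArg (graphMap _ _ _) (proj_graphMap i.2 _ y)

theorem isAnalyticPseudoMetricOn_traceMetric :
    IsAnalyticPseudoMetricOn (finPart K) traceMetric where
  linear_left E hE T := by
    have : FiniteDimensional ℝ E.space := hE
    have h := fun S => traceMetric_eq_sum_inner (stdOrthonormalBasis ℝ E.space) S T
    constructor
    · intro S S'
      rw [h S, h S', ← Finset.sum_add_distrib]
      exact (h _).trans (Finset.sum_congr rfl fun k _ => inner_add_left _ _ _)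
    · intro c S
      rw [h S, smul_eq_mul, Finset.mul_sum]
      exact (h _).trans (Finset.sum_congr rfl fun k _ => real_inner_smul_left _ _ _)
  symm E hE S T := by
    have : FiniteDimensional ℝ E.space := hE
    have h := traceMetric_eq_sum_inner (stdOrthonormalBasis ℝ E.space)
    rw [h S T, h T S]
    exact Finset.sum_congr rfl fun k _ => real_inner_comm _ _
  nonneg E hE S := by
    have : FiniteDimensional ℝ E.space := hE
    rw [traceMetric_eq_sum_inner (stdOrthonormalBasis ℝ E.space) S S]
    exact Finset.sum_nonneg fun k _ => real_inner_self_nonneg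
  analytic := by
    rintro (i : ComplPair K) z ⟨⟨hz, hfin⟩, -⟩
    have : FiniteDimensional ℝ i.1.1.space := (finiteDimensional_graph_iff i z.1).1 hfin
    have hext := analyticAt_tangentChart_symm (M := Grassmannian K) mapAnalyticAt_extend hz
    have hS := (hext z.2.1).comp_of_eq
      (analyticAt_fst.prod (analyticAt_fst.comp analyticAt_snd)) (x := z) rfl
    have hT := (hext z.2.2).comp_of_eq
      (analyticAt_fst.prod (analyticAt_snd.comp analyticAt_snd)) (x := z) rfl
    have hstar := ((starL' ℝ : (K →L[ℝ] K) ≃L[ℝ] _).toContinuousLinearMap.analyticAt _).comp hS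
    refine (analyticAt_trace_comp_graphMap i (hstar.mul hT) analyticAt_fst).congr
      (.of_forall fun y => ?_)
    have htrace := traceMetric_eq_trace_comp_graphMap ((grChart i).map_target (mem_univ y.1))
    rw [(grChart i).right_inv (mem_univ y.1)] at htrace
    exact (htrace _ _).symm

theorem sq_norm_le_traceMetric {E : Grassmannian K} (hE : E ∈ finPart K)
    (S : E.space →L[ℝ] E.spaceᗮ) : ‖S‖ ^ 2 ≤ traceMetric E S S := by
  have : FiniteDimensional ℝ E.space := hE
  rw [traceMetric_eq_sum_inner (stdOrthonormalBasis ℝ E.space) S S]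
  simp only [real_inner_self_eq_norm_sq]
  exact sq_opNorm_le_sum_sq_norm _ S

theorem isAnalyticMetricOn_traceMetric : IsAnalyticMetricOn (finPart K) traceMetric where
  toIsAnalyticPseudoMetricOn := isAnalyticPseudoMetricOn_traceMetric
  definite E hE S h := by
    have hS := (sq_norm_le_traceMetric hE S).trans_eq h
    exact norm_eq_zero.1 (sq_nonpos_iff _ |>.1 hS)
  bounded_below E hE :=
    ⟨1, one_pos, fun S => (one_mul (‖S‖ ^ 2)).trans_le (sq_norm_le_traceMetric hE S)⟩

end FinitePart

end OrthogonalProjection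

end Grassmannian

open AnalyticBanachManifold in
theorem mainTheorem5 {K : Type u} [NormedAddCommGroup K] [InnerProductSpace ℝ K]
    [CompleteSpace K] :
    -- (a)
    (IsAnalyticImmersion (Grassmannian.tangentEmbedding K) ∧
      (∀ E : Grassmannian K,
        (∀ T : TangentSp E, (Grassmannian.tangentEmbedding K ⟨E, T⟩).1 = E) ∧
        IsLinearMap ℝ (fun T : TangentSp E => (Grassmannian.tangentEmbedding K ⟨E, T⟩).2)) ∧
      IsEmbedding (Grassmannian.tangentEmbedding K) ∧
      range (Grassmannian.tangentEmbedding K) = {p | p.2 ∈ Grassmannian.fibre p.1} ∧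
      IsAnalyticSubbundle (fun E : Grassmannian K => E.fibre)) ∧
    -- (b)
    ((∀ x : K, IsAnalyticPseudoMetricOn univ (Grassmannian.vecMetric x)) ∧
      IsSeparating (fun x : K => Grassmannian.vecMetric x) ∧
      (TopologicalSpace.SeparableSpace K →
        ∃ x : ℕ → K, IsSeparating (fun n => Grassmannian.vecMetric (x n)))) ∧
    -- (c)
    (IsOpen (Grassmannian.finPart K) ∧
      (∀ E ∈ Grassmannian.finPart K, ∀ S T : TangentSp E,
        FiniteDimensional ℝ (Grassmannian.opMetric E S T).range) ∧
      IsAnalyticMetricOn (Grassmannian.finPart K) Grassmannian.traceMetric) := by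
  exact ⟨⟨Grassmannian.isAnalyticImmersion_tangentEmbedding,
      fun E => ⟨fun _ => rfl, Grassmannian.isLinearMap_extend E⟩,
      Grassmannian.isEmbedding_tangentEmbedding, Grassmannian.range_tangentEmbedding,
      Grassmannian.isAnalyticSubbundle_fibre⟩,
    ⟨Grassmannian.isAnalyticPseudoMetricOn_vecMetric,
      Grassmannian.isSeparating_of_denseRange denseRange_id,
      fun _ => ⟨TopologicalSpace.denseSeq K,
        Grassmannian.isSeparating_of_denseRange (TopologicalSpace.denseRange_denseSeq K)⟩⟩,
    ⟨Grassmannian.isOpen_finPart,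
      fun _ hE S T => Grassmannian.finiteDimensional_range_opMetric hE S T,
      Grassmannian.isAnalyticMetricOn_traceMetric⟩⟩
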